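/- Let $d\ge 1$ and $1\le p,q<\infty$, and fix $\psi\in\mathcal S(\mathbb R^d)$ with $\operatorname{supp}\psi\subset[-1,1]^d$ and $\sum_{k\in\mathbb Z^d}\psi(\xi-k)=1$ for all $\xi\in\mathbb R^d$. With $\widehat f(\xi)=\int f(x)e^{-2\pi i x\cdot\xi}\,dx$, set for $f\in\mathcal S'(\mathbb R^d)$, $j\in\mathbb Z$, $k\in\mathbb Z^d$ $$\psi_{j,k}(D)f(x)=\int_{\mathbb R^d}\psi(2^{-j}\xi-k)\widehat f(\xi)e^{2\pi i x\cdot\xi}\,d\xi,\qquad \|f\|_{M^{p,q}_{[j]}}=\Big(\sum_{k\in\mathbb Z^d}\|\psi_{j,k}(D)f\|_{L^p(\mathbb R^d)}^q\Big)^{1/q}\in[0,\infty]$$ (the integral being understood as a distributional pairing), and, for $1\le r<\infty$ and a weight $w=(w_j)_{j\in\mathbb Z}$ with $w_j\ge 0$, $$\|f\|_{\mathfrak M^{p,q,r}_w}=\Big(\sum_{j\in\mathbb Z}w_j^r\|f\|_{M^{p,q}_{[j]}}^r\Big)^{1/r}\in[0,\infty],\qquad \mathfrak M^{p,q,r}_w=\{f\in\mathcal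 S'(\mathbb R^d):\|f\|_{\mathfrak M^{p,q,r}_w}<\infty\}.$$ Call $w$ good if there are $\varepsilon>0$ and $A$ such that $w_j\le A\,2^{-\varepsilon j}$ for $j\ge0$ and $w_j\le A\,2^{-(\frac d{p'}-\frac dq-\varepsilon)j}$ for $j<0$, where $\frac1{p'}=1-\frac1p$. Let $S(t)=e^{-it\Delta}$ be the Fourier multiplier operator on $\mathcal S'(\mathbb R^d)$ with symbol $e^{4\pi^2 it|\xi|^2}$, and let $\langle x\rangle=(1+|x|^2)^{1/2}$. Then there is a constant $C$, depending only on $d,p,q,\psi$, such that the following hold. (a) For all $j\in\mathbb Z$, $t\in\mathbb R$ and $f\in\mathcal S'(\mathbb R^d)$, $$\|S(t)f\|_{M^{p,q}_{[j]}}\le C\,\langle 2^{2j}t\rangle^{d|\frac12-\frac1p|}\,\|f\|_{M^{p,q}_{[j]}}.$$ (b) Let $1\le r<\infty$, let $w$ be a good weight, and put $\sigma_j=2^{-jd|1-\frac2p|}w_j$ for $j\ge0$ and $\sigma_j=w_j$ for $j<0$. Then $\sigma$ is a good weight, and for every $t\in\mathbb R$ the operator $S(t)$ maps $\mathfrak M^{p,q,r}_w$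 into $\mathfrak M^{p,q,r}_\sigma$, with $$\|S(t)f\|_{\mathfrak M^{p,q,r}_\sigma}\le C\,\langle t\rangle^{d|\frac12-\frac1p|}\,\|f\|_{\mathfrak M^{p,q,r}_w}\qquad\text{for all } f\in\mathcal S'(\mathbb R^d).$$ -/

import Mathlib

open MeasureTheory Set
open scoped ENNReal NNReal SchwartzMap FourierTransform

namespace ScaledModulation

/-- The Euclidean space `ℝ^d`. -/
abbrev Rd (d : ℕ) := EuclideanSpace ℝ (Fin d)

/-- The point of `ℝ^d` with the integer coordinates `k ∈ ℤ^d`. -/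
noncomputable def latticePoint {d : ℕ} (k : Fin d → ℤ) : Rd d :=
  WithLp.toLp 2 (fun i => (k i : ℝ))

/-- `ψ ∈ 𝓢(ℝ^d)` generates a uniform partition of unity: `supp ψ ⊆ [-1,1]^d` and
`∑_{k ∈ ℤ^d} ψ(ξ - k) = 1` for all `ξ`. -/
structure IsUniformPartition {d : ℕ} (ψ : 𝓢(Rd d, ℂ)) : Prop where
  support_subset : tsupport (ψ : Rd d → ℂ) ⊆ {ξ | ∀ i, ξ i ∈ Icc (-1 : ℝ) 1}
  sum_eq_one : ∀ ξ : Rd d, HasSum (fun k : Fin d → ℤ => ψ (ξ - latticePoint k)) 1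

/-- Multiplication by `2^{-j}` as a linear automorphism of `ℝ^d`. -/
noncomputable def dyadicScaling (d : ℕ) (j : ℤ) : Rd d ≃L[ℝ] Rd d :=
  ContinuousLinearEquiv.smulLeft (Units.mk0 ((2 : ℝ) ^ (-j)) (zpow_ne_zero _ two_ne_zero))

/-- The multiplier `ψ_{j,k}(ξ) = ψ(2^{-j} ξ - k)`, as a Schwartz function. -/
noncomputable def multiplier {d : ℕ} (ψ : 𝓢(Rd d, ℂ)) (j : ℤ) (k : Fin d → ℤ) : 𝓢(Rd d, ℂ) :=
  SchwartzMap.compCLMOfContinuousLinearEquiv ℂ (dyadicScaling d j)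
    (SchwartzMap.compSubConstCLM ℂ (latticePoint k) ψ)

theorem multiplier_apply {d : ℕ} (ψ : 𝓢(Rd d, ℂ)) (j : ℤ) (k : Fin d → ℤ) (ξ : Rd d) :
    multiplier ψ j k ξ = ψ ((2 : ℝ) ^ (-j) • ξ - latticePoint k) := rfl

theorem hasTemperateGrowth_cexp_I :
    (fun y : ℝ => Complex.exp (y * Complex.I)).HasTemperateGrowth := by
  have hder : ∀ n : ℕ, iteratedDeriv n (fun y : ℝ => Complex.exp (y * Complex.I))
      = fun y : ℝ => Complex.I ^ n * Complex.exp (y * Complex.I) := by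
    intro n
    induction n with
    | zero => simp
    | succ n ih =>
      rw [iteratedDeriv_succ, ih]
      funext y
      have h1 : HasDerivAt (fun y : ℝ => (y : ℂ) * Complex.I) (1 * Complex.I) y :=
        (Complex.ofRealCLM.hasDerivAt (x := y)).mul_const Complex.I
      have h2 := (h1.cexp.const_mul (Complex.I ^ n)).deriv
      rw [h2]
      ring
  refine ⟨?_, fun n => ⟨0, 1, fun y => ?_⟩⟩
  · exact Complex.contDiff_exp.comp (Complex.ofRealCLM.contDiff.mul contDiff_const)
  · rw [norm_iteratedFDeriv_eq_norm_iteratedDeriv, hder]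
    simp [Complex.norm_exp_ofReal_mul_I]

/-- The character `ξ ↦ e^{2 π i x·ξ}`. -/
noncomputable def character {d : ℕ} (x ξ : Rd d) : ℂ :=
  Complex.exp ((2 * Real.pi * inner ℝ x ξ : ℝ) * Complex.I)

theorem hasTemperateGrowth_character {d : ℕ} (x : Rd d) : (character x).HasTemperateGrowth :=
  hasTemperateGrowth_cexp_I.comp (f := fun ξ : Rd d => 2 * Real.pi * inner ℝ x ξ) (by fun_prop)

/-- The smooth function `ψ_{j,k}(D) f (x) = ∫ ψ(2^{-j} ξ - k) f̂(ξ) e^{2 π i x·ξ} dξ`; as `f` is a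
tempered distribution, the integral is the value of `f̂` at the Schwartz function
`ξ ↦ e^{2 π i x·ξ} ψ(2^{-j} ξ - k)`. -/
noncomputable def piece {d : ℕ} (ψ : 𝓢(Rd d, ℂ)) (j : ℤ) (k : Fin d → ℤ) (f : 𝓢'(Rd d, ℂ))
    (x : Rd d) : ℂ :=
  (𝓕 f : 𝓢'(Rd d, ℂ)) (SchwartzMap.smulLeftCLM ℂ (character x) (multiplier ψ j k))

/-- For a Schwartz function `f` the piece is the familiar integral. -/
theorem piece_coe {d : ℕ} (ψ : 𝓢(Rd d, ℂ)) (j : ℤ) (k : Fin d → ℤ) (f : 𝓢(Rd d, ℂ)) (x : Rd d) :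
    piece ψ j k (f : 𝓢'(Rd d, ℂ)) x =
      ∫ ξ, ψ ((2 : ℝ) ^ (-j) • ξ - latticePoint k) * (𝓕 f) ξ *
        Complex.exp ((2 * Real.pi * inner ℝ x ξ : ℝ) * Complex.I) := by
  rw [piece, TemperedDistribution.fourier_toTemperedDistributionCLM_eq]
  simp only [SchwartzMap.toTemperedDistributionCLM_apply_apply]
  refine integral_congr_ae (Filter.Eventually.of_forall fun ξ => ?_)
  simp only [SchwartzMap.smulLeftCLM_apply_apply (hasTemperateGrowth_character x),
    multiplier_apply, smul_eq_mul, character]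
  ring

/-- The norm of the scaled modulation space `M^{p,q}_{[j]}`, with values in `[0,∞]`. -/
noncomputable def scaleNorm {d : ℕ} (ψ : 𝓢(Rd d, ℂ)) (p q : ℝ) (j : ℤ) (f : 𝓢'(Rd d, ℂ)) : ℝ≥0∞ :=
  (∑' k : Fin d → ℤ, (eLpNorm (piece ψ j k f) (ENNReal.ofReal p) volume) ^ q) ^ (1 / q)

/-- The norm of the modulation space with scaling `𝔐^{p,q,r}_w`, with values in `[0,∞]`. -/
noncomputable def modNorm {d : ℕ} (ψ : 𝓢(Rd d, ℂ)) (p q r : ℝ) (w : ℤ → ℝ≥0) (f : 𝓢'(Rd d, ℂ)) :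
    ℝ≥0∞ :=
  (∑' j : ℤ, (w j : ℝ≥0∞) ^ r * (scaleNorm ψ p q j f) ^ r) ^ (1 / r)

/-- The space `𝔐^{p,q,r}_w(ℝ^d)` of tempered distributions of finite norm. -/
def modSpace {d : ℕ} (ψ : 𝓢(Rd d, ℂ)) (p q r : ℝ) (w : ℤ → ℝ≥0) : Set (𝓢'(Rd d, ℂ)) :=
  {f | modNorm ψ p q r w f < ∞}

/-- Good weights: for some `ε > 0`, `w_j ≲ 2^{-ε j}` for `j ≥ 0` and
`w_j ≲ 2^{-(d/p' - d/q - ε) j}` for `j < 0`, where `1/p' = 1 - 1/p`. -/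
def GoodWeight (d : ℕ) (p q : ℝ) (w : ℤ → ℝ≥0) : Prop :=
  ∃ ε > (0 : ℝ), ∃ A : ℝ,
    (∀ j : ℤ, 0 ≤ j → (w j : ℝ) ≤ A * (2 : ℝ) ^ (-(ε * j))) ∧
    (∀ j : ℤ, j < 0 → (w j : ℝ) ≤ A * (2 : ℝ) ^ (-((d * (1 - 1 / p) - d / q - ε) * j)))

/-- The weight `σ_j = 2^{-j d |1 - 2/p|} w_j` for `j ≥ 0` and `σ_j = w_j` for `j < 0`. -/
noncomputable def dampedWeight (d : ℕ) (p : ℝ) (w : ℤ → ℝ≥0) (j : ℤ) : ℝ≥0 :=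
  if 0 ≤ j then (2 : ℝ≥0) ^ (-((j : ℝ) * d * |1 - 2 / p|)) * w j else w j

/-- The symbol `e^{4 π² i t |ξ|²}` of `S(t) = e^{-itΔ}`. -/
noncomputable def schrodingerSymbol {d : ℕ} (t : ℝ) (ξ : Rd d) : ℂ :=
  Complex.exp ((4 * Real.pi ^ 2 * t * ‖ξ‖ ^ 2 : ℝ) * Complex.I)

/-- The symbol has temperate growth, so that it does act as a multiplier on `𝓢'(ℝ^d)`. -/
theorem hasTemperateGrowth_schrodingerSymbol {d : ℕ} (t : ℝ) :
    (schrodingerSymbol (d := d) t).HasTemperateGrowth :=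
  hasTemperateGrowth_cexp_I.comp (f := fun ξ : Rd d => 4 * Real.pi ^ 2 * t * ‖ξ‖ ^ 2)
    (by fun_prop)

/-- The Schrödinger operator `S(t) = e^{-itΔ}` on tempered distributions, the Fourier multiplier
operator with the symbol `e^{4 π² i t |ξ|²}`. -/
noncomputable def S {d : ℕ} (t : ℝ) (f : 𝓢'(Rd d, ℂ)) : 𝓢'(Rd d, ℂ) :=
  TemperedDistribution.fourierMultiplierCLM ℂ (schrodingerSymbol t) f

/-- `⟨x⟩ = (1 + |x|²)^{1/2}`. -/
noncomputable def japanese (x : ℝ) : ℝ := Real.sqrt (1 + |x| ^ 2)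

end ScaledModulation

open ScaledModulation

/-! On each frequency cube the Schrödinger operator is a convolution. Since `ψ` lives in the unit
cube, a smooth cutoff adapted to the cube `(j, k)` can be inserted into the symbol for free, so the
piece of `S t f` is the piece of `f` convolved with a Schwartz kernel (`piece_S`). The kernel's
Fourier transform is bounded by `1`, which gives an `L²` bound independent of time. Its `L¹` norm,
which controls `L¹` and `L^∞`, is at most a constant times `⟨2^{2j} t⟩^{d/2}`. Interpolation raises
this `L¹` bound to the power `|1 - 2/p|`, which is the exponent `d|1/2 - 1/p|`.

The `L¹` norm depends on `j` and `t` only through `2^{2j} t` and not at all on `k`, by dilation and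
Galilean invariance (`lintegral_fourierInv_multiplier`). For the unit cube, the localized symbol is
a fixed Schwartz function times `e^{-π b |ξ|²}` with `b = 1 - 4πiτ`, whose inverse transform has
`L¹` norm `|b|^{d/2}` (`exists_lintegral_fourierInv_cutoff_le`).

The interpolation is done by hand, with truncation heights proportional to a power of the `L¹`
bound, so that the sharp power of that bound survives (`exists_lintegral_kernelOp_rpow_le`).

For a tempered `f` the convolution identity amounts to moving a continuous functional under an
integral over modulations. The functional is factored through a Banach space, where Bochner
integration applies (`commutesWithModulationIntegral_functional`).

Part (a) follows by summing over `k`. Part (b) follows by summing over `j`, since the damping for `j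
≥ 0` cancels exactly the growth of `⟨2^{2j} t⟩` against `⟨t⟩`. -/

namespace ScaledModulation

/-! ### Modulations of Schwartz functions and their behaviour under differentiation. -/

section Modulation

variable {d : ℕ} {F : Type} [NormedAddCommGroup F] [NormedSpace ℝ F] [NormedSpace ℂ F]

theorem norm_character (x ξ : Rd d) : ‖character x ξ‖ = 1 :=
  Complex.norm_exp_ofReal_mul_I _

theorem character_add (x y ξ : Rd d) : character (x + y) ξ = character x ξ * character y ξ := by
  rw [character, character, character, ← Complex.exp_add]
  congr 1
  push_cast [inner_add_left]
  ring

theorem hasFDerivAt_character (x ξ : Rd d) :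
    HasFDerivAt (character x)
      ((2 * Real.pi * Complex.I * character x ξ) • Complex.ofRealCLM ∘L innerSL ℝ x) ξ := by
  have h1 : HasFDerivAt (fun ξ : Rd d => (inner ℝ x ξ : ℝ)) (innerSL ℝ x) ξ :=
    (innerSL ℝ x).hasFDerivAt
  have h2 := ((Complex.ofRealCLM.hasFDerivAt.comp ξ (h1.const_mul (2 * Real.pi))).mul_const
    Complex.I).cexp
  convert! h2 using 1
  ext v
  simp [character]
  ring

theorem norm_character_sub_le (x y ξ : Rd d) :
    ‖character x ξ - character y ξ‖ ≤ 2 * Real.pi * (‖x - y‖ * ‖ξ‖) := by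
  have h : character x ξ - character y ξ = character y ξ * (character (x - y) ξ - 1) := by
    rw [mul_sub, ← character_add, add_sub_cancel, mul_one]
  rw [h, norm_mul, norm_character, one_mul, character, mul_comm _ Complex.I]
  refine (Real.norm_exp_I_mul_ofReal_sub_one_le).trans ?_
  rw [norm_mul, Real.norm_of_nonneg (by positivity)]
  gcongr
  exact norm_inner_le_norm _ _

/-- The tensor product of the `i`-th coordinate functional with a vector. -/
noncomputable def coordSMulRight (d : ℕ) (F : Type) [NormedAddCommGroup F] [NormedSpace ℝ F]
    [NormedSpace ℂ F] (i : Fin d) : F →L[ℂ] (Rd d →L[ℝ] F) :=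
  LinearMap.mkContinuous
    { toFun := fun y => (EuclideanSpace.proj i : Rd d →L[ℝ] ℝ).smulRight y
      map_add' := fun y z => by ext v; simp
      map_smul' := fun c y => by ext v; exact smul_comm _ _ _ }
    ‖(EuclideanSpace.proj i : Rd d →L[ℝ] ℝ)‖
    (fun y => by simp [ContinuousLinearMap.norm_smulRight_apply])

@[simp]
theorem coordSMulRight_apply (i : Fin d) (y : F) (v : Rd d) :
    coordSMulRight d F i y v = v i • y := rfl

/-- The derivative of the character is expanded in coordinates so that `x` enters only through
modulations and scalar coefficients. The Schwartz functions being modulated stay fixed, which is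
what an induction on the order of differentiation needs. -/
theorem fderivCLM_smulLeftCLM_character (x : Rd d) (χ : 𝓢(Rd d, F)) :
    SchwartzMap.fderivCLM ℂ (Rd d) F (SchwartzMap.smulLeftCLM F (character x) χ) =
      SchwartzMap.smulLeftCLM _ (character x) (SchwartzMap.fderivCLM ℂ (Rd d) F χ) +
      ∑ i, (2 * Real.pi * Complex.I * x i : ℂ) • SchwartzMap.smulLeftCLM _ (character x)
        (SchwartzMap.postcompCLM (coordSMulRight d F i) χ) := by
  have hx := hasTemperateGrowth_character x
  ext ξ v
  rw [SchwartzMap.fderivCLM_apply, SchwartzMap.smulLeftCLM_apply hx]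
  have h := (hasFDerivAt_character x ξ).smul (χ.hasFDerivAt ξ)
  have h' : fderiv ℝ (fun ξ => character x ξ • χ ξ) ξ = _ := h.fderiv
  rw [h']
  simp only [add_apply, sum_apply, smul_apply,
    SchwartzMap.smulLeftCLM_apply_apply hx, SchwartzMap.postcompCLM_apply,
    coordSMulRight_apply, SchwartzMap.fderivCLM_apply, ContinuousLinearMap.smulRight_apply]
  congr 1
  have : inner ℝ x v = ∑ i, x i * v i := by
    simp [PiLp.inner_apply, mul_comm]
  simp [this, Finset.mul_sum, Finset.sum_smul]
  refine Finset.sum_congr rfl fun i _ => ?_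
  rw [← algebraMap_smul ℂ (v i) (χ ξ), smul_smul, smul_smul, Complex.coe_algebraMap]
  congr 1
  ring

/-- The multiplication of a Schwartz function by `-2 π i x_i`, which on the Fourier side is the
`i`-th partial derivative. -/
noncomputable def coordMul (i : Fin d) (K : 𝓢(Rd d, ℂ)) : 𝓢(Rd d, ℂ) :=
  -(2 * Real.pi * Complex.I) •
    SchwartzMap.smulLeftCLM ℂ (fun y => inner ℝ y (EuclideanSpace.single i (1 : ℝ))) K

theorem coordMul_apply (i : Fin d) (K : 𝓢(Rd d, ℂ)) (y : Rd d) :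
    coordMul i K y = K y * (2 * Real.pi * Complex.I * (-y) i) := by
  have h : (fun y : Rd d => inner ℝ y (EuclideanSpace.single i (1 : ℝ))).HasTemperateGrowth := by
    fun_prop
  have h' : inner ℝ y (EuclideanSpace.single i (1 : ℝ)) = y i := by
    rw [EuclideanSpace.inner_single_right]
    simp
  simp [coordMul, SchwartzMap.smulLeftCLM_apply_apply h, h']
  ring

theorem fderiv_fourier_apply (K : 𝓢(Rd d, ℂ)) (ξ v : Rd d) :
    fderiv ℝ (𝓕 K : 𝓢(Rd d, ℂ)) ξ v = ∑ i, v i • (𝓕 (coordMul i K) : 𝓢(Rd d, ℂ)) ξ := by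
  have hv : v = ∑ i, v i • EuclideanSpace.single i (1 : ℝ) := by
    simpa using ((EuclideanSpace.basisFun (Fin d) ℝ).sum_repr v).symm
  conv_lhs => rw [hv]
  rw [map_sum]
  refine Finset.sum_congr rfl fun i _ => ?_
  rw [map_smul, coordMul, ← SchwartzMap.lineDerivOp_fourier_eq,
    SchwartzMap.lineDerivOp_apply_eq_fderiv]

/-- Companion of `fderivCLM_smulLeftCLM_character`: the coefficients `2πi x_i` at `x = -y` are here
absorbed into the kernel by `coordMul`, so the two formulas match term by term under the integral in
`y`. -/
theorem fderivCLM_smulLeftCLM_fourier (K : 𝓢(Rd d, ℂ)) (χ : 𝓢(Rd d, F)) :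
    SchwartzMap.fderivCLM ℂ (Rd d) F (SchwartzMap.smulLeftCLM F (𝓕 K : 𝓢(Rd d, ℂ)) χ) =
      SchwartzMap.smulLeftCLM _ (𝓕 K : 𝓢(Rd d, ℂ)) (SchwartzMap.fderivCLM ℂ (Rd d) F χ) +
      ∑ i, SchwartzMap.smulLeftCLM _ (𝓕 (coordMul i K) : 𝓢(Rd d, ℂ))
        (SchwartzMap.postcompCLM (coordSMulRight d F i) χ) := by
  have hK (K : 𝓢(Rd d, ℂ)) := K.hasTemperateGrowth
  ext ξ v
  rw [SchwartzMap.fderivCLM_apply, SchwartzMap.smulLeftCLM_apply (hK _)]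
  have h := ((𝓕 K : 𝓢(Rd d, ℂ)).hasFDerivAt ξ).smul (χ.hasFDerivAt ξ)
  have h' : fderiv ℝ (fun ξ => (𝓕 K : 𝓢(Rd d, ℂ)) ξ • χ ξ) ξ = _ := h.fderiv
  rw [h']
  simp only [add_apply, sum_apply, smul_apply,
    SchwartzMap.smulLeftCLM_apply_apply (hK _), SchwartzMap.postcompCLM_apply,
    coordSMulRight_apply, SchwartzMap.fderivCLM_apply, ContinuousLinearMap.smulRight_apply]
  congr 1
  rw [fderiv_fourier_apply, Finset.sum_smul]
  refine Finset.sum_congr rfl fun i _ => ?_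
  rw [smul_assoc, smul_comm]

theorem integrable_smul_of_polynomial_growth {G : Type} [NormedAddCommGroup G] [NormedSpace ℂ G]
    (K : 𝓢(Rd d, ℂ)) {g : Rd d → G} (hg : AEStronglyMeasurable g) {C : ℝ} {n : ℕ}
    (hC : ∀ y, ‖g y‖ ≤ C * (1 + ‖y‖) ^ n) : Integrable fun y => K y • g y := by
  have h1 : Integrable fun y : Rd d => C * (2 ^ (n - 1) * (‖K y‖ + ‖y‖ ^ n * ‖K y‖)) :=
    ((K.integrable.norm.add (K.integrable_pow_mul volume n)).const_mul _).const_mul _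
  refine h1.mono' (K.continuous.aestronglyMeasurable.smul hg) (.of_forall fun y => ?_)
  have h2 : (1 + ‖y‖) ^ n ≤ 2 ^ (n - 1) * (1 + ‖y‖ ^ n) := by
    simpa using add_pow_le zero_le_one (norm_nonneg y) n
  have hC0 : 0 ≤ C := by simpa using (norm_nonneg _).trans (hC 0)
  calc ‖K y • g y‖ ≤ ‖K y‖ * (C * (2 ^ (n - 1) * (1 + ‖y‖ ^ n))) := by
        rw [norm_smul]
        gcongr
        exact (hC y).trans (by gcongr)
    _ = _ := by ring

/-- A continuous linear map on Schwartz functions that may be exchanged with the integral over the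
modulations of a Schwartz function. -/
structure CommutesWithModulationIntegral {G : Type} [NormedAddCommGroup G] [NormedSpace ℝ G]
    [NormedSpace ℂ G]
    (J : 𝓢(Rd d, F) →L[ℂ] G) : Prop where
  continuous : ∀ χ, Continuous fun x => J (SchwartzMap.smulLeftCLM F (character x) χ)
  bound : ∀ χ, ∃ (C : ℝ) (n : ℕ), ∀ x,
    ‖J (SchwartzMap.smulLeftCLM F (character x) χ)‖ ≤ C * (1 + ‖x‖) ^ n
  integral : ∀ (K : 𝓢(Rd d, ℂ)) (χ : 𝓢(Rd d, F)),
    J (SchwartzMap.smulLeftCLM F (𝓕 K : 𝓢(Rd d, ℂ)) χ) =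
      ∫ y, K y • J (SchwartzMap.smulLeftCLM F (character (-y)) χ)

namespace CommutesWithModulationIntegral

variable {G : Type} [NormedAddCommGroup G] [NormedSpace ℝ G] [NormedSpace ℂ G]

theorem integrable {J : 𝓢(Rd d, F) →L[ℂ] G} (hJ : CommutesWithModulationIntegral J)
    (K : 𝓢(Rd d, ℂ)) (χ : 𝓢(Rd d, F)) :
    Integrable fun y => K y • J (SchwartzMap.smulLeftCLM F (character (-y)) χ) := by
  obtain ⟨C, n, h⟩ := hJ.bound χ
  refine integrable_smul_of_polynomial_growth K
    ((hJ.continuous χ).comp continuous_neg).aestronglyMeasurable (C := C) (n := n) fun y => ?_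
  simpa using h (-y)

theorem comp {G' : Type} [NormedAddCommGroup G'] [NormedSpace ℝ G'] [NormedSpace ℂ G']
    [CompleteSpace G] [CompleteSpace G'] {J : 𝓢(Rd d, F) →L[ℂ] G}
    (hJ : CommutesWithModulationIntegral J) (ℓ : G →L[ℂ] G') :
    CommutesWithModulationIntegral (ℓ ∘L J) where
  continuous χ := ℓ.continuous.comp (hJ.continuous χ)
  bound χ := by
    obtain ⟨C, n, h⟩ := hJ.bound χ
    refine ⟨‖ℓ‖ * C, n, fun x => (ℓ.le_opNorm _).trans ?_⟩
    rw [mul_assoc]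
    gcongr
    exact h x
  integral K χ := by
    rw [ContinuousLinearMap.comp_apply, hJ.integral, ← ℓ.integral_comp_comm (hJ.integrable K χ)]
    simp

/-- Needed because a continuous functional on Schwartz space is dominated by finitely many
seminorms, not by a single one. -/
theorem pi {ι : Type} [Fintype ι] {H : ι → Type} [∀ i, NormedAddCommGroup (H i)]
    [∀ i, NormedSpace ℝ (H i)] [∀ i, NormedSpace ℂ (H i)] [∀ i, CompleteSpace (H i)]
    {J : ∀ i, 𝓢(Rd d, F) →L[ℂ] H i}
    (hJ : ∀ i, CommutesWithModulationIntegral (J i)) :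
    CommutesWithModulationIntegral (ContinuousLinearMap.pi J) where
  continuous χ := continuous_pi fun i => (hJ i).continuous χ
  bound χ := by
    choose C n h using fun i => (hJ i).bound χ
    have hC i : 0 ≤ C i := by simpa using (norm_nonneg _).trans (h i 0)
    refine ⟨∑ i, C i, ∑ i, n i, fun x => ?_⟩
    have h0 : 0 ≤ ∑ i, C i := Finset.sum_nonneg fun i _ => hC i
    refine (pi_norm_le_iff_of_nonneg (by positivity)).2 fun i => (h i x).trans ?_
    gcongr
    · exact Finset.single_le_sum (fun i _ => hC i) (Finset.mem_univ i)
    · linarith [norm_nonneg x]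
    · exact Finset.single_le_sum (fun i _ => Nat.zero_le (n i)) (Finset.mem_univ i)
  integral K χ := by
    ext i
    rw [ContinuousLinearMap.pi_apply, (hJ i).integral, eval_integral]
    · rfl
    · exact fun i => (hJ i).integrable K χ

theorem comp_fderivCLM [SMulCommClass ℝ ℂ F] {J : 𝓢(Rd d, Rd d →L[ℝ] F) →L[ℂ] G}
    (hJ : CommutesWithModulationIntegral J) :
    CommutesWithModulationIntegral (J ∘L SchwartzMap.fderivCLM ℂ (Rd d) F) where
  continuous χ := by
    simp only [ContinuousLinearMap.comp_apply, fderivCLM_smulLeftCLM_character, map_add, map_sum,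
      map_smul]
    refine (hJ.continuous _).add (continuous_finsetSum _ fun i _ => ?_)
    exact Continuous.smul (by fun_prop) (hJ.continuous _)
  bound χ := by
    choose C n h using hJ.bound
    let D := SchwartzMap.fderivCLM ℂ (Rd d) F χ
    let E := fun i => SchwartzMap.postcompCLM (coordSMulRight d F i) χ
    have hC χ : 0 ≤ C χ := by simpa using (norm_nonneg _).trans (h χ 0)
    -- A sum serves as a crude maximum of the degrees; the extra `1` pays for the coefficient `x i`.
    let N := n D + ∑ i, (n (E i) + 1)
    refine ⟨C D + ∑ i, 2 * Real.pi * C (E i), N, fun x => ?_⟩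
    have h1 : 1 ≤ 1 + ‖x‖ := by linarith [norm_nonneg x]
    simp only [ContinuousLinearMap.comp_apply, fderivCLM_smulLeftCLM_character, map_add, map_sum,
      map_smul, add_mul, Finset.sum_mul]
    refine (norm_add_le _ _).trans (add_le_add ?_ ((norm_sum_le _ _).trans
      (Finset.sum_le_sum fun i _ => ?_)))
    · refine (h D x).trans ?_
      have := hC D
      gcongr
      exact Nat.le_add_right _ _
    · have h2 : n (E i) + 1 ≤ N := (Finset.single_le_sum (f := fun i => n (E i) + 1)
        (fun i _ => Nat.zero_le _) (Finset.mem_univ i)).trans (Nat.le_add_left _ _)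
      have h3 : ‖x i‖ ≤ 1 + ‖x‖ := (PiLp.norm_apply_le x i).trans (by linarith)
      have h4 := hC (E i)
      calc _ ≤ (2 * Real.pi * (1 + ‖x‖)) * (C (E i) * (1 + ‖x‖) ^ n (E i)) := by
            rw [norm_smul]
            refine mul_le_mul ?_ (h _ x) (norm_nonneg _) (by positivity)
            simp only [norm_mul, Complex.norm_ofNat, Complex.norm_real, Complex.norm_I, mul_one,
              Real.norm_of_nonneg Real.pi_pos.le]
            gcongr
        _ = 2 * Real.pi * C (E i) * (1 + ‖x‖) ^ (n (E i) + 1) := by ring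
        _ ≤ _ := by gcongr
  integral K χ := by
    simp only [ContinuousLinearMap.comp_apply, fderivCLM_smulLeftCLM_character,
      fderivCLM_smulLeftCLM_fourier, map_add, map_sum, map_smul, hJ.integral, smul_add,
      Finset.smul_sum, smul_smul, ← coordMul_apply]
    rw [integral_add (hJ.integrable _ _) (integrable_finsetSum _ fun i _ => hJ.integrable _ _),
      integral_finsetSum _ fun i _ => hJ.integrable _ _]

end CommutesWithModulationIntegral

end Modulation

/-! ### Exchanging a continuous functional with an integral over modulations. -/

section Exchange

variable {d : ℕ} {F : Type} [NormedAddCommGroup F] [NormedSpace ℝ F] [NormedSpace ℂ F]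

open scoped BoundedContinuousFunction

/-- Multiplication by the weight `(1 + |x|²)^k`, followed by the inclusion into the bounded
continuous functions. -/
noncomputable def weightedBCF [SMulCommClass ℝ ℂ F] (k : ℕ) : 𝓢(Rd d, F) →L[ℂ] (Rd d →ᵇ F) :=
  SchwartzMap.toBoundedContinuousFunctionCLM ℂ (Rd d) F ∘L
    SchwartzMap.smulLeftCLM F (fun x : Rd d => ((1 + ‖x‖ ^ 2 : ℝ) : ℂ) ^ k)

theorem hasTemperateGrowth_weight (k : ℕ) :
    (fun x : Rd d => ((1 + ‖x‖ ^ 2 : ℝ) : ℂ) ^ k).HasTemperateGrowth := by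
  fun_prop

theorem weightedBCF_apply [SMulCommClass ℝ ℂ F] (k : ℕ) (φ : 𝓢(Rd d, F)) (x : Rd d) :
    weightedBCF k φ x = ((1 + ‖x‖ ^ 2 : ℝ) : ℂ) ^ k • φ x := by
  simp only [weightedBCF, ContinuousLinearMap.comp_apply,
    SchwartzMap.toBoundedContinuousFunctionCLM_apply]
  rw [SchwartzMap.smulLeftCLM_apply_apply (hasTemperateGrowth_weight k)]

theorem seminorm_le_norm_weightedBCF [SMulCommClass ℝ ℂ F] (k : ℕ) (φ : 𝓢(Rd d, F)) :
    SchwartzMap.seminorm ℂ k 0 φ ≤ ‖weightedBCF k φ‖ := by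
  refine SchwartzMap.seminorm_le_bound ℂ k 0 φ (norm_nonneg _) fun x => ?_
  refine le_trans ?_ ((weightedBCF k φ).norm_coe_le_norm x)
  rw [weightedBCF_apply, norm_smul, norm_pow, norm_iteratedFDeriv_zero, Complex.norm_real,
    Real.norm_of_nonneg (by positivity)]
  gcongr
  nlinarith [sq_nonneg (‖x‖ - 1), norm_nonneg x]

/-- Characters at `x` and `y` differ at `ξ` by at most `2π‖x - y‖‖ξ‖`, and the decay of the Schwartz
function absorbs `‖ξ‖`; this gives Lipschitz continuity in the sup norm. The integral identity is
tested at each point `ξ`, where it is the definition of `𝓕 K`. -/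
theorem commutesWithModulationIntegral_weightedBCF [SMulCommClass ℝ ℂ F] [CompleteSpace F]
    (k : ℕ) : CommutesWithModulationIntegral (weightedBCF k : 𝓢(Rd d, F) →L[ℂ] (Rd d →ᵇ F)) := by
  have hcont (χ : 𝓢(Rd d, F)) :
      Continuous fun x => weightedBCF k (SchwartzMap.smulLeftCLM F (character x) χ) := by
    let χ' := SchwartzMap.smulLeftCLM F (fun x : Rd d => ((1 + ‖x‖ ^ 2 : ℝ) : ℂ) ^ k) χ
    have hχ' : ∀ ξ, χ' ξ = ((1 + ‖ξ‖ ^ 2 : ℝ) : ℂ) ^ k • χ ξ :=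
      SchwartzMap.smulLeftCLM_apply_apply (hasTemperateGrowth_weight k) χ
    let C := SchwartzMap.seminorm ℝ 1 0 χ'
    have hC : ∀ ξ, ‖ξ‖ * ‖χ' ξ‖ ≤ C := fun ξ => by
      simpa using SchwartzMap.norm_pow_mul_le_seminorm ℝ χ' 1 ξ
    have hC0 : 0 ≤ C := by simpa using hC 0
    refine (LipschitzWith.of_dist_le_mul (K := (2 * Real.pi * C).toNNReal)
      fun x y => ?_).continuous
    rw [Real.coe_toNNReal _ (by positivity)]
    refine (BoundedContinuousFunction.dist_le (by positivity)).2 fun ξ => ?_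
    rw [weightedBCF_apply, weightedBCF_apply,
      SchwartzMap.smulLeftCLM_apply_apply (hasTemperateGrowth_character _),
      SchwartzMap.smulLeftCLM_apply_apply (hasTemperateGrowth_character _), smul_comm,
      smul_comm _ (character y ξ), ← hχ', dist_eq_norm, ← sub_smul, norm_smul, dist_eq_norm]
    calc _ ≤ 2 * Real.pi * (‖x - y‖ * ‖ξ‖) * ‖χ' ξ‖ := by
          gcongr
          exact norm_character_sub_le x y ξ
      _ = 2 * Real.pi * ‖x - y‖ * (‖ξ‖ * ‖χ' ξ‖) := by ring
      _ ≤ 2 * Real.pi * ‖x - y‖ * C := by gcongr; exact hC ξ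
      _ = _ := by ring
  have hbound (χ : 𝓢(Rd d, F)) (x : Rd d) :
      ‖weightedBCF k (SchwartzMap.smulLeftCLM F (character x) χ)‖ ≤ ‖weightedBCF k χ‖ := by
    refine (BoundedContinuousFunction.norm_le (norm_nonneg _)).2 fun ξ => ?_
    refine le_trans (le_of_eq ?_) ((weightedBCF k χ).norm_coe_le_norm ξ)
    rw [weightedBCF_apply, weightedBCF_apply,
      SchwartzMap.smulLeftCLM_apply_apply (hasTemperateGrowth_character _), smul_comm, norm_smul,
      norm_character, one_mul]
  refine ⟨hcont, fun χ => ⟨‖weightedBCF k χ‖, 0, fun x => by simpa using hbound χ x⟩,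
    fun K χ => ?_⟩
  ext ξ
  have hint : Integrable fun y => K y • weightedBCF k
      (SchwartzMap.smulLeftCLM F (character (-y)) χ) :=
    integrable_smul_of_polynomial_growth K
      ((hcont χ).comp continuous_neg).aestronglyMeasurable (C := ‖weightedBCF k χ‖) (n := 0)
      fun y => by simpa using hbound χ (-y)
  have := ((BoundedContinuousFunction.evalCLM ℂ ξ).integral_comp_comm hint).symm
  rw [BoundedContinuousFunction.evalCLM_apply] at this
  refine Eq.trans ?_ this.symm
  rw [weightedBCF_apply, SchwartzMap.smulLeftCLM_apply_apply (SchwartzMap.hasTemperateGrowth _),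
    SchwartzMap.fourier_coe, Real.fourier_eq', smul_comm, ← integral_smul_const]
  refine integral_congr_ae (.of_forall fun y => ?_)
  simp only [map_smul, BoundedContinuousFunction.evalCLM_apply]
  rw [weightedBCF_apply, SchwartzMap.smulLeftCLM_apply_apply (hasTemperateGrowth_character _),
    smul_comm _ (character _ _), smul_smul, smul_eq_mul, character, mul_comm]
  simp [mul_assoc, mul_left_comm, mul_comm (K y), smul_smul]

/-- Each derivative replaces the target `F` by `Rd d →L[ℝ] F`, so the induction on `n` must run over
all targets. -/
theorem exists_commutesWithModulationIntegral (n : ℕ) (F : Type) [NormedAddCommGroup F]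
    [NormedSpace ℝ F] [NormedSpace ℂ F] [SMulCommClass ℝ ℂ F] [CompleteSpace F] (k : ℕ) :
    ∃ (G : Type) (_ : NormedAddCommGroup G) (_ : NormedSpace ℝ G) (_ : NormedSpace ℂ G)
      (_ : CompleteSpace G)
      (J : 𝓢(Rd d, F) →L[ℂ] G), CommutesWithModulationIntegral J ∧
      ∀ φ, SchwartzMap.seminorm ℂ k n φ ≤ ‖J φ‖ := by
  induction n generalizing F with
  | zero =>
    exact ⟨Rd d →ᵇ F, inferInstance, inferInstance, inferInstance, inferInstance, weightedBCF k,
      commutesWithModulationIntegral_weightedBCF k, seminorm_le_norm_weightedBCF k⟩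
  | succ n ih =>
    obtain ⟨G, _, _, _, hG, J, hJ, h⟩ := ih (Rd d →L[ℝ] F)
    refine ⟨G, _, _, _, hG, J ∘L SchwartzMap.fderivCLM ℂ (Rd d) F, hJ.comp_fderivCLM, fun φ => ?_⟩
    refine le_trans ?_ (h _)
    refine SchwartzMap.seminorm_le_bound ℂ k (n + 1) φ (apply_nonneg _ _) fun x => ?_
    rw [← norm_iteratedFDeriv_fderiv]
    exact SchwartzMap.le_seminorm ℂ k n (SchwartzMap.fderivCLM ℂ (Rd d) F φ) x

/-- A linear functional bounded by the norm of a linear map factors through this map. -/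
theorem exists_comp_eq_of_norm_le {V G : Type} [AddCommGroup V] [Module ℂ V]
    [NormedAddCommGroup G] [NormedSpace ℂ G] (L : V →ₗ[ℂ] ℂ) (ι : V →ₗ[ℂ] G) (C : ℝ)
    (h : ∀ v, ‖L v‖ ≤ C * ‖ι v‖) : ∃ ℓ : G →L[ℂ] ℂ, ∀ v, ℓ (ι v) = L v := by
  have hker : LinearMap.ker ι ≤ LinearMap.ker L := fun v hv => by
    have := h v
    rw [LinearMap.mem_ker.1 hv, norm_zero, mul_zero] at this
    simpa using this
  -- The functional descends to the range of `ι` because the bound forces `ker ι ≤ ker L`;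
  -- Hahn–Banach then extends it to `G`.
  let g : LinearMap.range ι →ₗ[ℂ] ℂ :=
    (LinearMap.ker ι).liftQ L hker ∘ₗ ι.quotKerEquivRange.symm.toLinearMap
  have hg (v : V) : g ⟨ι v, LinearMap.mem_range_self ι v⟩ = L v := by
    have : ι.quotKerEquivRange.symm ⟨ι v, LinearMap.mem_range_self ι v⟩ =
        (LinearMap.ker ι).mkQ v := by
      rw [LinearEquiv.symm_apply_eq]
      rfl
    simp [g, this]
  obtain ⟨ℓ, hℓ, -⟩ := exists_extension_norm_eq (LinearMap.range ι)
    (g.mkContinuous C fun w => by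
      obtain ⟨w, v, rfl⟩ := w
      rw [hg]
      exact h v)
  exact ⟨ℓ, fun v => (hℓ ⟨ι v, LinearMap.mem_range_self ι v⟩).trans (hg v)⟩

/-- Continuity bounds `L` by finitely many seminorms, each dominated by the norm of a map with the
exchange property. Hence `L` factors through their product, and the remaining bounded functional
commutes with Bochner integrals. -/
theorem commutesWithModulationIntegral_functional (L : 𝓢(Rd d, ℂ) →L[ℂ] ℂ) :
    CommutesWithModulationIntegral L := by
  choose G i1 i2 i3 i4 J hJ h using fun m : ℕ × ℕ =>
    exists_commutesWithModulationIntegral (d := d) m.2 ℂ m.1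
  obtain ⟨s, C, -, hC⟩ := Seminorm.bound_of_continuous (schwartz_withSeminorms ℂ (Rd d) ℂ)
    ((normSeminorm ℂ ℂ).comp (L : 𝓢(Rd d, ℂ) →ₗ[ℂ] ℂ)) (continuous_norm.comp L.continuous)
  let ι : 𝓢(Rd d, ℂ) →L[ℂ] (∀ m : s, G m) := ContinuousLinearMap.pi fun m : s => J m
  have hι : CommutesWithModulationIntegral ι :=
    CommutesWithModulationIntegral.pi fun m : s => hJ m
  obtain ⟨ℓ, hℓ⟩ := exists_comp_eq_of_norm_le (L : 𝓢(Rd d, ℂ) →ₗ[ℂ] ℂ)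
    (ι : 𝓢(Rd d, ℂ) →ₗ[ℂ] (∀ m : s, G m)) C (fun φ => by
      refine (hC φ).trans ?_
      rw [smul_apply, NNReal.smul_def, smul_eq_mul]
      refine mul_le_mul_of_nonneg_left ?_ C.2
      refine Seminorm.finset_sup_apply_le (norm_nonneg _) fun m hm => ?_
      exact (h m φ).trans (norm_le_pi_norm (ι φ) ⟨m, hm⟩))
  have : L = ℓ ∘L ι := ContinuousLinearMap.ext fun φ => (hℓ φ).symm
  rw [this]
  exact hι.comp ℓ

end Exchange

/-! ### Convolution with a Schwartz kernel: endpoint and `L²` bounds. -/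

section KernelOperator

open Filter Topology

variable {d : ℕ}

/-- The convolution of a function with the kernel `K`. -/
noncomputable def kernelOp (K : 𝓢(Rd d, ℂ)) (v : Rd d → ℂ) (x : Rd d) : ℂ :=
  ∫ y, K y * v (x - y)

/-- Measurable functions of at most polynomial growth. -/
structure PolynomialGrowth (v : Rd d → ℂ) : Prop where
  measurable : Measurable v
  bound : ∃ (C : ℝ) (n : ℕ), ∀ x, ‖v x‖ ≤ C * (1 + ‖x‖) ^ n

theorem PolynomialGrowth.mono {u v : Rd d → ℂ} (hu : PolynomialGrowth u) (hv : Measurable v)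
    (h : ∀ x, ‖v x‖ ≤ ‖u x‖) : PolynomialGrowth v := by
  obtain ⟨C, n, hC⟩ := hu.bound
  exact ⟨hv, C, n, fun x => (h x).trans (hC x)⟩

theorem PolynomialGrowth.integrable {v : Rd d → ℂ} (hv : PolynomialGrowth v) (K : 𝓢(Rd d, ℂ))
    (x : Rd d) : Integrable fun y => K y * v (x - y) := by
  obtain ⟨C, n, hC⟩ := hv.bound
  have hC0 : 0 ≤ C := by simpa using (norm_nonneg _).trans (hC 0)
  refine integrable_smul_of_polynomial_growth K (C := C * (1 + ‖x‖) ^ n) (n := n)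
    (hv.measurable.comp (measurable_const.sub measurable_id)).aestronglyMeasurable fun y => ?_
  refine (hC _).trans ?_
  -- The growth bound follows from `1 + ‖x - y‖ ≤ (1 + ‖x‖)(1 + ‖y‖)`.
  rw [mul_assoc, ← mul_pow]
  gcongr
  nlinarith [norm_sub_le x y, norm_nonneg x, norm_nonneg y,
    mul_nonneg (norm_nonneg x) (norm_nonneg y)]

theorem polynomialGrowth_schwartz (φ : 𝓢(Rd d, ℂ)) : PolynomialGrowth φ :=
  ⟨φ.continuous.measurable, SchwartzMap.seminorm ℝ 0 0 φ, 0, fun x => by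
    simpa using SchwartzMap.norm_le_seminorm ℝ φ x⟩

theorem aestronglyMeasurable_kernelOp (K : 𝓢(Rd d, ℂ)) {v : Rd d → ℂ} (hv : Measurable v) :
    AEStronglyMeasurable (kernelOp K v) := by
  have h : Measurable fun z : Rd d × Rd d => K z.2 * v (z.1 - z.2) :=
    (K.continuous.measurable.comp measurable_snd).mul
      (hv.comp (measurable_fst.sub measurable_snd))
  exact h.stronglyMeasurable.integral_prod_right.aestronglyMeasurable

theorem kernelOp_add (K : 𝓢(Rd d, ℂ)) {u v : Rd d → ℂ} (hu : PolynomialGrowth u)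
    (hv : PolynomialGrowth v) (x : Rd d) :
    kernelOp K (fun x => u x + v x) x = kernelOp K u x + kernelOp K v x := by
  simp only [kernelOp, mul_add]
  exact integral_add (hu.integrable K x) (hv.integrable K x)

theorem enorm_kernelOp_le (K : 𝓢(Rd d, ℂ)) (v : Rd d → ℂ) (x : Rd d) :
    ‖kernelOp K v x‖ₑ ≤ ∫⁻ y, ‖K y‖ₑ * ‖v (x - y)‖ₑ := by
  refine (enorm_integral_le_lintegral_enorm _).trans_eq ?_
  simp only [enorm_mul]

theorem enorm_kernelOp_le_of_bound (K : 𝓢(Rd d, ℂ)) {v : Rd d → ℂ} {s : ℝ≥0∞}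
    (hv : ∀ x, ‖v x‖ₑ ≤ s) (x : Rd d) : ‖kernelOp K v x‖ₑ ≤ (∫⁻ y, ‖K y‖ₑ) * s := by
  refine (enorm_kernelOp_le K v x).trans ?_
  rw [← lintegral_mul_const _ K.continuous.measurable.enorm]
  exact lintegral_mono fun y => by gcongr; exact hv _

theorem lintegral_enorm_kernelOp_le (K : 𝓢(Rd d, ℂ)) {v : Rd d → ℂ} (hv : Measurable v) :
    ∫⁻ x, ‖kernelOp K v x‖ₑ ≤ (∫⁻ y, ‖K y‖ₑ) * ∫⁻ x, ‖v x‖ₑ := by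
  refine (lintegral_mono (enorm_kernelOp_le K v)).trans ?_
  rw [lintegral_lintegral_swap]
  · rw [← lintegral_mul_const _ K.continuous.measurable.enorm]
    refine lintegral_mono fun y => ?_
    have hy : Measurable fun x => ‖v (x - y)‖ₑ := (hv.comp (measurable_id.sub_const y)).enorm
    rw [lintegral_const_mul _ hy,
      lintegral_sub_right_eq_self (fun x => ‖v x‖ₑ) y]
  · exact ((K.continuous.measurable.comp measurable_snd).enorm.mul
      (hv.comp (measurable_fst.sub measurable_snd)).enorm).aemeasurable

theorem eLpNorm_fourier_two (φ : 𝓢(Rd d, ℂ)) :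
    eLpNorm (𝓕 φ : 𝓢(Rd d, ℂ)) 2 volume = eLpNorm φ 2 volume := by
  have h := SchwartzMap.norm_fourier_toL2_eq φ
  rw [SchwartzMap.norm_toLp, SchwartzMap.norm_toLp] at h
  exact (ENNReal.toReal_eq_toReal_iff' (SchwartzMap.eLpNorm_lt_top _ _ _).ne
    (SchwartzMap.eLpNorm_lt_top _ _ _).ne).1 h

theorem kernelOp_eq_convolution (K φ : 𝓢(Rd d, ℂ)) :
    kernelOp K φ = SchwartzMap.convolution (ContinuousLinearMap.mul ℂ ℂ) K φ := by
  ext x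
  rw [SchwartzMap.convolution_apply]
  rfl

theorem eLpNorm_kernelOp_two_schwartz_le (K φ : 𝓢(Rd d, ℂ)) {B : ℝ}
    (hB : ∀ ξ, ‖(𝓕 K : 𝓢(Rd d, ℂ)) ξ‖ ≤ B) :
    eLpNorm (kernelOp K φ) 2 volume ≤ ENNReal.ofReal B * eLpNorm φ 2 volume := by
  rw [kernelOp_eq_convolution, ← eLpNorm_fourier_two, ← eLpNorm_fourier_two φ,
    SchwartzMap.fourier_convolution]
  refine eLpNorm_le_mul_eLpNorm_of_ae_le_mul (.of_forall fun ξ => ?_) 2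
  rw [SchwartzMap.pairing_apply_apply, ContinuousLinearMap.mul_apply', norm_mul]
  gcongr
  exact hB ξ

theorem eLpNorm_mul_one_le {u v : Rd d → ℂ} (hu : Measurable u) (hv : Measurable v) :
    eLpNorm (fun y => u y * v y) 1 volume ≤ eLpNorm u 2 volume * eLpNorm v 2 volume := by
  have := eLpNorm_smul_le_mul_eLpNorm (μ := volume) (p := 2) (q := 2) (r := 1)
    hv.aestronglyMeasurable hu.aestronglyMeasurable
  exact this

/-- Cauchy–Schwarz turns `L²` convergence of the inputs into pointwise convergence of the
convolutions, as required for the density argument in `eLpNorm_kernelOp_two_le`. -/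
theorem enorm_kernelOp_le_eLpNorm_two (K : 𝓢(Rd d, ℂ)) {v : Rd d → ℂ} (hv : Measurable v)
    (x : Rd d) : ‖kernelOp K v x‖ₑ ≤ eLpNorm K 2 volume * eLpNorm v 2 volume := by
  have h1 : ‖kernelOp K v x‖ₑ ≤ eLpNorm (fun y => K y * v (x - y)) 1 volume := by
    rw [eLpNorm_one_eq_lintegral_enorm]
    exact enorm_integral_le_lintegral_enorm _
  have h2 : eLpNorm (fun y => v (x - y)) 2 volume = eLpNorm v 2 volume :=
    eLpNorm_comp_measurePreserving (f := fun y => x - y) hv.aestronglyMeasurable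
      (Measure.measurePreserving_sub_left volume x)
  have hvx : Measurable fun y => v (x - y) := hv.comp (measurable_const.sub measurable_id)
  have h3 := eLpNorm_mul_one_le K.continuous.measurable hvx
  rw [h2] at h3
  exact h1.trans h3

/-- Plancherel gives the bound for Schwartz inputs. These approximate `v` in `L²`, the convolutions
converge pointwise, and Fatou's lemma passes the bound to the limit. -/
theorem eLpNorm_kernelOp_two_le (K : 𝓢(Rd d, ℂ)) {B : ℝ} (hB0 : 0 < B)
    (hB : ∀ ξ, ‖(𝓕 K : 𝓢(Rd d, ℂ)) ξ‖ ≤ B) {v : Rd d → ℂ} (hv : PolynomialGrowth v) :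
    eLpNorm (kernelOp K v) 2 volume ≤ ENNReal.ofReal B * eLpNorm v 2 volume := by
  by_cases hv2 : MemLp v 2 volume
  swap
  · have : eLpNorm v 2 volume = ∞ := by
      by_contra h
      exact hv2 ⟨hv.measurable.aestronglyMeasurable, lt_top_iff_ne_top.2 h⟩
    -- Positivity of `B` matters here: the right side must be `∞`, not `0 * ∞ = 0`.
    rw [this, ENNReal.mul_top (by simpa using hB0)]
    exact le_top
  have : Fact ((1 : ℝ≥0∞) ≤ 2) := ⟨one_le_two⟩
  obtain ⟨g, hg, hlim⟩ := mem_closure_iff_seq_limit.1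
    ((SchwartzMap.denseRange_toLpCLM (E := Rd d) (F := ℂ) (μ := volume) (p := 2)
      ENNReal.ofNat_ne_top) (hv2.toLp v))
  choose φ hφ using hg
  have hlim' : Tendsto (fun n => eLpNorm (fun x => φ n x - v x) 2 volume) atTop (𝓝 0) := by
    have := (Lp.tendsto_Lp_iff_tendsto_eLpNorm' g (hv2.toLp v)).1 hlim
    refine this.congr fun n => eLpNorm_congr_ae ?_
    have h1 : (g n : Rd d → ℂ) =ᵐ[volume] φ n := by
      rw [← hφ n, SchwartzMap.toLpCLM_apply]
      exact SchwartzMap.coeFn_toLp _ _ _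
    filter_upwards [h1, hv2.coeFn_toLp] with x h1 h2
    simp [h1, h2]
  have hpt (x : Rd d) : Tendsto (fun n => kernelOp K (φ n) x) atTop (𝓝 (kernelOp K v x)) := by
    rw [tendsto_iff_edist_tendsto_0]
    have hK : eLpNorm K 2 volume ≠ ∞ := (K.eLpNorm_lt_top 2 volume).ne
    have h0 : Tendsto (fun n => eLpNorm K 2 volume * eLpNorm (fun x => φ n x - v x) 2 volume)
        atTop (𝓝 0) := by
      simpa using ENNReal.Tendsto.const_mul hlim' (Or.inr hK)
    refine tendsto_of_tendsto_of_tendsto_of_le_of_le tendsto_const_nhds h0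
      (fun _ => zero_le) fun n => ?_
    have h1 : kernelOp K (φ n) x - kernelOp K v x = kernelOp K (fun x => φ n x - v x) x := by
      simp only [kernelOp, mul_sub]
      exact (integral_sub ((polynomialGrowth_schwartz (φ n)).integrable K x)
        (hv.integrable K x)).symm
    simp only [edist_eq_enorm_sub, h1]
    exact enorm_kernelOp_le_eLpNorm_two K ((φ n).continuous.measurable.sub hv.measurable) x
  refine (Lp.eLpNorm_lim_le_liminf_eLpNorm
    (fun n => aestronglyMeasurable_kernelOp K (φ n).continuous.measurable) _
    (.of_forall hpt)).trans ?_
  have h2 : Tendsto (fun n => ENNReal.ofReal B *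
      (eLpNorm v 2 volume + eLpNorm (fun x => φ n x - v x) 2 volume)) atTop
      (𝓝 (ENNReal.ofReal B * eLpNorm v 2 volume)) := by
    simpa using ENNReal.Tendsto.const_mul (tendsto_const_nhds.add hlim')
      (Or.inr ENNReal.ofReal_ne_top)
  rw [← h2.liminf_eq]
  refine liminf_le_liminf (.of_forall fun n => ?_)
  refine (eLpNorm_kernelOp_two_schwartz_le K (φ n) hB).trans ?_
  gcongr
  have h3 : (φ n : Rd d → ℂ) = v + fun x => φ n x - v x := by
    ext x
    simp
  conv_lhs => rw [h3]
  exact eLpNorm_add_le hv.measurable.aestronglyMeasurable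
    ((φ n).continuous.measurable.sub hv.measurable).aestronglyMeasurable one_le_two

theorem eLpNorm_two_sq (v : Rd d → ℂ) : eLpNorm v 2 volume ^ 2 = ∫⁻ x, ‖v x‖ₑ ^ 2 := by
  simpa using eLpNorm_nnreal_pow_eq_lintegral (f := v) (μ := volume) (p := 2) two_ne_zero

theorem lintegral_enorm_sq_kernelOp_le (K : 𝓢(Rd d, ℂ)) {B : ℝ} (hB0 : 0 < B)
    (hB : ∀ ξ, ‖(𝓕 K : 𝓢(Rd d, ℂ)) ξ‖ ≤ B) {v : Rd d → ℂ} (hv : PolynomialGrowth v) :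
    ∫⁻ x, ‖kernelOp K v x‖ₑ ^ 2 ≤ ENNReal.ofReal (B ^ 2) * ∫⁻ x, ‖v x‖ₑ ^ 2 := by
  rw [← eLpNorm_two_sq, ← eLpNorm_two_sq, ENNReal.ofReal_pow hB0.le, ← mul_pow]
  gcongr
  exact eLpNorm_kernelOp_two_le K hB0 hB hv

end KernelOperator

/-! ### Real interpolation between `L¹`, `L²` and `L^∞` with explicit dependence on the `L¹` bound.
-/

section Interpolation

/-- Layer-cake formula followed by Tonelli: a majorant of the distribution function that is itself
an integral over `x` leaves only a one-variable integral in `s` for each fixed `x`. -/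
theorem lintegral_rpow_le_of_distribution {α : Type} [MeasurableSpace α] {μ : Measure α}
    [SFinite μ] {f : α → ℝ} (hf0 : ∀ x, 0 ≤ f x) (hf : AEMeasurable f μ) {p : ℝ} (hp : 0 < p)
    {Ψ : ℝ → α → ℝ≥0∞} (hΨ : Measurable (Function.uncurry Ψ))
    (h : ∀ s > 0, μ {x | s < f x} ≤ ∫⁻ x, Ψ s x ∂μ) :
    ∫⁻ x, ENNReal.ofReal (f x ^ p) ∂μ ≤
      ENNReal.ofReal p * ∫⁻ x, (∫⁻ s in Ioi (0 : ℝ), Ψ s x * ENNReal.ofReal (s ^ (p - 1))) ∂μ := by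
  rw [lintegral_rpow_eq_lintegral_meas_lt_mul μ (.of_forall hf0) hf hp]
  gcongr
  rw [lintegral_lintegral_swap]
  · refine setLIntegral_mono' measurableSet_Ioi fun s hs => ?_
    have hs' : Measurable (Ψ s) := hΨ.comp measurable_prodMk_left
    rw [lintegral_mul_const _ hs']
    gcongr
    exact h s hs
  · exact ((hΨ.comp measurable_swap).mul (by fun_prop)).aemeasurable

theorem lintegral_Ioo_rpow {b s : ℝ} (hb : 0 ≤ b) (hs : -1 < s) :
    ∫⁻ t in Ioo 0 b, ENNReal.ofReal (t ^ s) = ENNReal.ofReal (b ^ (s + 1) / (s + 1)) := by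
  have hint : IntegrableOn (fun t : ℝ => t ^ s) (Ioo 0 b) :=
    ((intervalIntegrable_iff_integrableOn_Ioc_of_le hb).1
      (intervalIntegral.intervalIntegrable_rpow' hs)).mono_set Ioo_subset_Ioc_self
  rw [← ofReal_integral_eq_lintegral_ofReal hint
    ((ae_restrict_iff' measurableSet_Ioo).2 (.of_forall fun t ht => Real.rpow_nonneg ht.1.le s)),
    ← integral_Ioc_eq_integral_Ioo, ← intervalIntegral.integral_of_le hb,
    integral_rpow (Or.inl hs), Real.zero_rpow (by linarith), sub_zero]

theorem lintegral_Ici_rpow {b s : ℝ} (hb : 0 < b) (hs : s < -1) :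
    ∫⁻ t in Ici b, ENNReal.ofReal (t ^ s) = ENNReal.ofReal (-b ^ (s + 1) / (s + 1)) := by
  rw [setLIntegral_congr Ioi_ae_eq_Ici.symm, ← ofReal_integral_eq_lintegral_ofReal
    (integrableOn_Ioi_rpow_of_lt hs hb) ((ae_restrict_iff' measurableSet_Ioi).2
      (.of_forall fun t ht => Real.rpow_nonneg (hb.trans ht).le s)),
    integral_Ioi_rpow_of_lt hs hb]

variable {d : ℕ}

theorem enorm_rpow_eq (z : ℂ) {p : ℝ} (hp : 0 ≤ p) : ‖z‖ₑ ^ p = ENNReal.ofReal (‖z‖ ^ p) := by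
  rw [← ofReal_norm, ENNReal.ofReal_rpow_of_nonneg (norm_nonneg z) hp]

theorem meas_half_le_norm_le {g : Rd d → ℂ} (hg : AEStronglyMeasurable g) {s : ℝ} (hs : 0 < s)
    (k : ℕ) : volume {x | s / 2 ≤ ‖g x‖} ≤ ENNReal.ofReal ((2 / s) ^ k) * ∫⁻ x, ‖g x‖ₑ ^ k := by
  have h1 := mul_meas_ge_le_lintegral₀ (μ := volume) (hg.enorm.pow_const k)
    (ENNReal.ofReal ((s / 2) ^ k))
  have h2 : {x | s / 2 ≤ ‖g x‖} ⊆ {x | ENNReal.ofReal ((s / 2) ^ k) ≤ ‖g x‖ₑ ^ k} := by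
    intro x hx
    rw [mem_ofPred_eq, ← ofReal_norm, ← ENNReal.ofReal_pow (norm_nonneg _)]
    exact ENNReal.ofReal_le_ofReal (pow_le_pow_left₀ (by positivity) hx k)
  have h3 : ENNReal.ofReal ((2 / s) ^ k) * ENNReal.ofReal ((s / 2) ^ k) = 1 := by
    rw [← ENNReal.ofReal_mul (by positivity), ← mul_pow, div_mul_div_cancel₀ hs.ne', div_self
      two_ne_zero, one_pow, ENNReal.ofReal_one]
  calc volume {x | s / 2 ≤ ‖g x‖}
      ≤ volume {x | ENNReal.ofReal ((s / 2) ^ k) ≤ ‖g x‖ₑ ^ k} := measure_mono h2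
    _ = ENNReal.ofReal ((2 / s) ^ k) * (ENNReal.ofReal ((s / 2) ^ k) *
          volume {x | ENNReal.ofReal ((s / 2) ^ k) ≤ ‖g x‖ₑ ^ k}) := by
        rw [← mul_assoc, h3, one_mul]
    _ ≤ _ := by gcongr

/-- The part of `u` of size at most `s`. -/
noncomputable def smallPart (u : Rd d → ℂ) (s : ℝ) (x : Rd d) : ℂ := if ‖u x‖ ≤ s then u x else 0

/-- The part of `u` of size more than `s`. -/
noncomputable def largePart (u : Rd d → ℂ) (s : ℝ) (x : Rd d) : ℂ := if ‖u x‖ ≤ s then 0 else u x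

theorem measurable_smallPart {u : Rd d → ℂ} (hu : Measurable u) :
    Measurable fun z : ℝ × Rd d => smallPart u z.1 z.2 :=
  Measurable.ite (measurableSet_le (hu.comp measurable_snd).norm measurable_fst)
    (hu.comp measurable_snd) measurable_const

theorem measurable_largePart {u : Rd d → ℂ} (hu : Measurable u) :
    Measurable fun z : ℝ × Rd d => largePart u z.1 z.2 :=
  Measurable.ite (measurableSet_le (hu.comp measurable_snd).norm measurable_fst)
    measurable_const (hu.comp measurable_snd)

theorem PolynomialGrowth.smallPart {u : Rd d → ℂ} (hu : PolynomialGrowth u) (s : ℝ) :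
    PolynomialGrowth (smallPart u s) :=
  hu.mono ((measurable_smallPart hu.measurable).comp measurable_prodMk_left) fun x => by
    unfold ScaledModulation.smallPart; split_ifs <;> simp

theorem PolynomialGrowth.largePart {u : Rd d → ℂ} (hu : PolynomialGrowth u) (s : ℝ) :
    PolynomialGrowth (largePart u s) :=
  hu.mono ((measurable_largePart hu.measurable).comp measurable_prodMk_left) fun x => by
    unfold ScaledModulation.largePart; split_ifs <;> simp

theorem norm_kernelOp_le_parts (K : 𝓢(Rd d, ℂ)) {u : Rd d → ℂ} (hu : PolynomialGrowth u) (s : ℝ)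
    (x : Rd d) :
    ‖kernelOp K u x‖ ≤ ‖kernelOp K (smallPart u s) x‖ + ‖kernelOp K (largePart u s) x‖ := by
  have h : u = fun x => smallPart u s x + largePart u s x := by
    ext x
    unfold smallPart largePart
    split_ifs <;> simp
  conv_lhs => rw [h]
  rw [kernelOp_add K (hu.smallPart s) (hu.largePart s)]
  exact norm_add_le _ _

section

variable {K : 𝓢(Rd d, ℂ)} {A B : ℝ}

/-- Used for `p > 2`. The height `s / (2 * A)` makes the image of the small part at most `s / 2`
everywhere, so only the large part counts, through Chebyshev in `L²`. -/
theorem distribution_kernelOp_le_of_large (hA : 0 < A) (hB0 : 0 < B)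
    (hKA : ∫⁻ y, ‖K y‖ₑ ≤ ENNReal.ofReal A) (hB : ∀ ξ, ‖(𝓕 K : 𝓢(Rd d, ℂ)) ξ‖ ≤ B)
    {u : Rd d → ℂ} (hu : PolynomialGrowth u) {s : ℝ} (hs : 0 < s) :
    volume {x | s < ‖kernelOp K u x‖} ≤ ∫⁻ x, ENNReal.ofReal ((2 / s) ^ 2) *
      (ENNReal.ofReal (B ^ 2) * ‖largePart u (s / (2 * A)) x‖ₑ ^ 2) := by
  have hl := hu.largePart (s / (2 * A))
  have hsmall (x : Rd d) : ‖kernelOp K (smallPart u (s / (2 * A))) x‖ ≤ s / 2 := by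
    have h1 : ∀ x, ‖smallPart u (s / (2 * A)) x‖ₑ ≤ ENNReal.ofReal (s / (2 * A)) := fun x => by
      rw [← ofReal_norm]
      refine ENNReal.ofReal_le_ofReal ?_
      unfold smallPart
      split_ifs with h
      · exact h
      · rw [norm_zero]; positivity
    have h2 := (enorm_kernelOp_le_of_bound K h1 x).trans
      (mul_le_mul_left hKA (ENNReal.ofReal (s / (2 * A))))
    rw [← ENNReal.ofReal_mul hA.le, ← ofReal_norm,
      ENNReal.ofReal_le_ofReal_iff (by positivity)] at h2
    refine h2.trans_eq ?_
    field_simp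
  have hsub : {x | s < ‖kernelOp K u x‖} ⊆
      {x | s / 2 ≤ ‖kernelOp K (largePart u (s / (2 * A))) x‖} := fun x hx => by
    have h1 := norm_kernelOp_le_parts K hu (s / (2 * A)) x
    have h2 := hsmall x
    simp only [mem_ofPred_eq] at hx ⊢
    linarith
  refine (measure_mono hsub).trans ((meas_half_le_norm_le
    (aestronglyMeasurable_kernelOp K hl.measurable) hs 2).trans ?_)
  have hm : Measurable fun x => ‖largePart u (s / (2 * A)) x‖ₑ ^ 2 :=
    hl.measurable.enorm.pow_const 2
  rw [lintegral_const_mul _ (hm.const_mul _), lintegral_const_mul _ hm]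
  gcongr
  exact lintegral_enorm_sq_kernelOp_le K hB0 hB hl

/-- Used for `1 < p < 2`, with `L²` for the small part and `L¹` for the large one. The height `A *
s` balances them: after integration in `s` both contribute `A ^ (2 - p) * ‖u x‖ ^ p` up to
constants. -/
theorem distribution_kernelOp_le_of_small (hB0 : 0 < B)
    (hKA : ∫⁻ y, ‖K y‖ₑ ≤ ENNReal.ofReal A) (hB : ∀ ξ, ‖(𝓕 K : 𝓢(Rd d, ℂ)) ξ‖ ≤ B)
    {u : Rd d → ℂ} (hu : PolynomialGrowth u) {s : ℝ} (hs : 0 < s) :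
    volume {x | s < ‖kernelOp K u x‖} ≤ ∫⁻ x, (ENNReal.ofReal ((2 / s) ^ 2) *
      (ENNReal.ofReal (B ^ 2) * ‖smallPart u (A * s) x‖ₑ ^ 2) +
      ENNReal.ofReal (2 / s) * (ENNReal.ofReal A * ‖largePart u (A * s) x‖ₑ)) := by
  have hl := hu.largePart (A * s)
  have hm := hu.smallPart (A * s)
  have hsub : {x | s < ‖kernelOp K u x‖} ⊆ {x | s / 2 ≤ ‖kernelOp K (smallPart u (A * s)) x‖} ∪
      {x | s / 2 ≤ ‖kernelOp K (largePart u (A * s)) x‖} := fun x hx => by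
    have h1 := norm_kernelOp_le_parts K hu (A * s) x
    simp only [mem_ofPred_eq, mem_union] at hx ⊢
    by_contra! h
    linarith [h.1, h.2]
  have hm2 : Measurable fun x => ‖smallPart u (A * s) x‖ₑ ^ 2 := hm.measurable.enorm.pow_const 2
  have hl1 : Measurable fun x => ‖largePart u (A * s) x‖ₑ := hl.measurable.enorm
  refine (measure_mono hsub).trans ((measure_union_le _ _).trans ?_)
  rw [lintegral_add_left ((hm2.const_mul _).const_mul _), lintegral_const_mul _ (hm2.const_mul _),
    lintegral_const_mul _ hm2, lintegral_const_mul _ (hl1.const_mul _), lintegral_const_mul _ hl1]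
  refine add_le_add ((meas_half_le_norm_le (aestronglyMeasurable_kernelOp K hm.measurable)
    hs 2).trans ?_) ((meas_half_le_norm_le (aestronglyMeasurable_kernelOp K hl.measurable)
    hs 1).trans ?_)
  · gcongr
    exact lintegral_enorm_sq_kernelOp_le K hB0 hB hm
  · simp only [pow_one]
    gcongr
    exact (lintegral_enorm_kernelOp_le K hl.measurable).trans (by gcongr)

/-- For fixed `x` the integrand lives on `s < 2 * A * ‖u x‖`, and `s ^ (p - 3)` is integrable at `0`
because `p > 2`. -/
theorem lintegral_largePart_sq {p : ℝ} (hp : 2 < p) (hA : 0 < A) (u : Rd d → ℂ) (x : Rd d) :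
    ∫⁻ s in Ioi 0, ENNReal.ofReal ((2 / s) ^ 2) *
      (ENNReal.ofReal (B ^ 2) * ‖largePart u (s / (2 * A)) x‖ₑ ^ 2) *
        ENNReal.ofReal (s ^ (p - 1)) =
      ENNReal.ofReal (4 * B ^ 2 * (2 ^ (p - 2) / (p - 2)) * A ^ (p - 2)) * ‖u x‖ₑ ^ p := by
  have h0 : 0 ≤ ‖u x‖ := norm_nonneg _
  have h1 : ∀ s ∈ Ioi (0 : ℝ), ENNReal.ofReal ((2 / s) ^ 2) *
      (ENNReal.ofReal (B ^ 2) * ‖largePart u (s / (2 * A)) x‖ₑ ^ 2) *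
        ENNReal.ofReal (s ^ (p - 1)) = (Ioo 0 (2 * A * ‖u x‖)).indicator
        (fun s => ENNReal.ofReal (4 * B ^ 2 * ‖u x‖ ^ 2) * ENNReal.ofReal (s ^ (p - 3))) s := by
    intro s hs
    have hs : 0 < s := hs
    unfold largePart
    by_cases h : ‖u x‖ ≤ s / (2 * A)
    · rw [if_pos h, indicator_of_notMem]
      · simp
      · intro hmem
        rw [le_div_iff₀ (by positivity)] at h
        linarith [hmem.2]
    · rw [if_neg h, indicator_of_mem]
      · rw [← ofReal_norm, ← ENNReal.ofReal_pow h0, ← ENNReal.ofReal_mul (by positivity),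
          ← ENNReal.ofReal_mul (by positivity), ← ENNReal.ofReal_mul (by positivity),
          ← ENNReal.ofReal_mul (by positivity)]
        congr 1
        have : s ^ (p - 1) = s ^ (p - 3) * s ^ 2 := by
          rw [← Real.rpow_natCast, ← Real.rpow_add hs]
          congr 1
          push_cast
          ring
        rw [this]
        field_simp
        ring
      · rw [not_le, div_lt_iff₀ (by positivity)] at h
        exact ⟨hs, by linarith⟩
  rw [setLIntegral_congr_fun measurableSet_Ioi h1, lintegral_indicator measurableSet_Ioo,
    Measure.restrict_restrict measurableSet_Ioo, inter_eq_left.2 Ioo_subset_Ioi_self,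
    lintegral_const_mul _ (by fun_prop), lintegral_Ioo_rpow (by positivity) (by linarith),
    enorm_rpow_eq _ (by linarith), ← ENNReal.ofReal_mul (by positivity), ← ENNReal.ofReal_mul]
  · congr 1
    have : ‖u x‖ ^ p = ‖u x‖ ^ 2 * ‖u x‖ ^ (p - 2) := by
      rw [← Real.rpow_natCast, ← Real.rpow_add_of_nonneg h0 (by norm_num) (by linarith)]
      congr 1
      push_cast
      ring
    rw [this, show p - 3 + 1 = p - 2 by ring, Real.mul_rpow (by positivity) h0,
      Real.mul_rpow zero_le_two hA.le]
    ring
  · have : 0 < p - 2 := by linarith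
    positivity

/-- The integrand lives on `s ≥ ‖u x‖ / A`, and `s ^ (p - 3)` is integrable at infinity because `p <
2`. -/
theorem lintegral_smallPart_sq {p : ℝ} (hp1 : 1 < p) (hp2 : p < 2) (hA : 0 < A) (u : Rd d → ℂ)
    (x : Rd d) :
    ∫⁻ s in Ioi 0, ENNReal.ofReal ((2 / s) ^ 2) *
      (ENNReal.ofReal (B ^ 2) * ‖smallPart u (A * s) x‖ₑ ^ 2) * ENNReal.ofReal (s ^ (p - 1)) =
      ENNReal.ofReal (4 * B ^ 2 / (2 - p) * A ^ (2 - p)) * ‖u x‖ₑ ^ p := by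
  have h0 : 0 ≤ ‖u x‖ := norm_nonneg _
  -- A zero of `u` would put the lower endpoint at `0`, where the power is not integrable.
  by_cases hux : u x = 0
  · have : ∀ s, smallPart u s x = 0 := fun s => by simp [smallPart, hux]
    simp [this, hux, show 0 < p by linarith]
  have hpos : 0 < ‖u x‖ := norm_pos_iff.2 hux
  have h1 : ∀ s ∈ Ioi (0 : ℝ), ENNReal.ofReal ((2 / s) ^ 2) *
      (ENNReal.ofReal (B ^ 2) * ‖smallPart u (A * s) x‖ₑ ^ 2) * ENNReal.ofReal (s ^ (p - 1)) =
        (Ici (‖u x‖ / A)).indicator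
        (fun s => ENNReal.ofReal (4 * B ^ 2 * ‖u x‖ ^ 2) * ENNReal.ofReal (s ^ (p - 3))) s := by
    intro s hs
    have hs : 0 < s := hs
    unfold smallPart
    by_cases h : ‖u x‖ ≤ A * s
    · rw [if_pos h, indicator_of_mem]
      · rw [← ofReal_norm, ← ENNReal.ofReal_pow h0, ← ENNReal.ofReal_mul (by positivity),
          ← ENNReal.ofReal_mul (by positivity), ← ENNReal.ofReal_mul (by positivity),
          ← ENNReal.ofReal_mul (by positivity)]
        congr 1
        have : s ^ (p - 1) = s ^ (p - 3) * s ^ 2 := by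
          rw [← Real.rpow_natCast, ← Real.rpow_add hs]
          congr 1
          push_cast
          ring
        rw [this]
        field_simp
        ring
      · rw [mem_Ici, div_le_iff₀ hA]
        linarith
    · rw [if_neg h, indicator_of_notMem]
      · simp
      · rw [mem_Ici, div_le_iff₀ hA]
        linarith
  have hsub : Ici (‖u x‖ / A) ⊆ Ioi 0 := Ici_subset_Ioi.2 (by positivity)
  rw [setLIntegral_congr_fun measurableSet_Ioi h1, lintegral_indicator measurableSet_Ici,
    Measure.restrict_restrict measurableSet_Ici, inter_eq_left.2 hsub,
    lintegral_const_mul _ (by fun_prop), lintegral_Ici_rpow (by positivity) (by linarith),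
    enorm_rpow_eq _ (by linarith), ← ENNReal.ofReal_mul (by positivity), ← ENNReal.ofReal_mul]
  · congr 1
    have : ‖u x‖ ^ p = ‖u x‖ ^ 2 * ‖u x‖ ^ (p - 2) := by
      rw [← Real.rpow_natCast, ← Real.rpow_add hpos]
      congr 1
      push_cast
      ring
    rw [this, show p - 3 + 1 = -(2 - p) by ring, show p - 2 = -(2 - p) by ring,
      Real.div_rpow h0 hA.le, Real.rpow_neg hA.le, div_inv_eq_mul, neg_div_neg_eq]
    ring
  · have : 0 < 2 - p := by linarith
    positivity

/-- The integrand lives on `s < ‖u x‖ / A`, and `s ^ (p - 2)` is integrable at `0` because `p > 1`.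
-/
theorem lintegral_largePart {p : ℝ} (hp1 : 1 < p) (hA : 0 < A) (u : Rd d → ℂ) (x : Rd d) :
    ∫⁻ s in Ioi 0, ENNReal.ofReal (2 / s) * (ENNReal.ofReal A * ‖largePart u (A * s) x‖ₑ) *
        ENNReal.ofReal (s ^ (p - 1)) =
      ENNReal.ofReal (2 / (p - 1) * A ^ (2 - p)) * ‖u x‖ₑ ^ p := by
  have h0 : 0 ≤ ‖u x‖ := norm_nonneg _
  have h1 : ∀ s ∈ Ioi (0 : ℝ), ENNReal.ofReal (2 / s) *
      (ENNReal.ofReal A * ‖largePart u (A * s) x‖ₑ) * ENNReal.ofReal (s ^ (p - 1)) =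
        (Ioo 0 (‖u x‖ / A)).indicator
        (fun s => ENNReal.ofReal (2 * A * ‖u x‖) * ENNReal.ofReal (s ^ (p - 2))) s := by
    intro s hs
    have hs : 0 < s := hs
    unfold largePart
    by_cases h : ‖u x‖ ≤ A * s
    · rw [if_pos h, indicator_of_notMem]
      · simp
      · intro hmem
        have := hmem.2
        rw [lt_div_iff₀ hA] at this
        linarith
    · rw [if_neg h, indicator_of_mem]
      · rw [← ofReal_norm, ← ENNReal.ofReal_mul (by positivity),
          ← ENNReal.ofReal_mul (by positivity), ← ENNReal.ofReal_mul (by positivity),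
          ← ENNReal.ofReal_mul (by positivity)]
        congr 1
        have : s ^ (p - 1) = s ^ (p - 2) * s := by
          rw [← Real.rpow_add_one hs.ne']
          congr 1
          ring
        rw [this]
        field_simp
      · refine ⟨hs, ?_⟩
        rw [lt_div_iff₀ hA]
        linarith
  rw [setLIntegral_congr_fun measurableSet_Ioi h1, lintegral_indicator measurableSet_Ioo,
    Measure.restrict_restrict measurableSet_Ioo, inter_eq_left.2 Ioo_subset_Ioi_self,
    lintegral_const_mul _ (by fun_prop), lintegral_Ioo_rpow (by positivity) (by linarith),
    enorm_rpow_eq _ (by linarith), ← ENNReal.ofReal_mul (by positivity), ← ENNReal.ofReal_mul]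
  · congr 1
    have h2 : ‖u x‖ ^ p = ‖u x‖ * ‖u x‖ ^ (p - 1) := by
      conv_rhs => rw [← Real.rpow_one ‖u x‖, ← Real.rpow_mul h0, one_mul]
      rw [← Real.rpow_add_of_nonneg h0 zero_le_one (by linarith)]
      congr 1
      ring
    have h3 : A ^ (2 - p) = A / A ^ (p - 1) := by
      rw [show 2 - p = 1 - (p - 1) by ring, Real.rpow_sub hA, Real.rpow_one]
    rw [h2, h3, show p - 2 + 1 = p - 1 by ring, Real.div_rpow h0 hA.le]
    ring
  · have : 0 < p - 1 := by linarith
    positivity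

end

/-- The power of `A` is the one Riesz–Thorin would give. The constants from truncation blow up as
`p` tends to `2`, or to `1` from above, so these two exponents are handled directly by the endpoint
bounds. -/
theorem exists_lintegral_kernelOp_rpow_le (d : ℕ) {p : ℝ} (hp : 1 ≤ p) {B : ℝ} (hB0 : 0 < B) :
    ∃ C > 0, ∀ A > 0, ∀ K : 𝓢(Rd d, ℂ), ∫⁻ y, ‖K y‖ₑ ≤ ENNReal.ofReal A →
      (∀ ξ, ‖(𝓕 K : 𝓢(Rd d, ℂ)) ξ‖ ≤ B) → ∀ u : Rd d → ℂ, PolynomialGrowth u →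
      ∫⁻ x, ‖kernelOp K u x‖ₑ ^ p ≤ ENNReal.ofReal (C * A ^ |p - 2|) * ∫⁻ x, ‖u x‖ₑ ^ p := by
  have hf0 (K : 𝓢(Rd d, ℂ)) (u : Rd d → ℂ) (x : Rd d) : 0 ≤ ‖kernelOp K u x‖ := norm_nonneg _
  rcases hp.eq_or_lt with rfl | hp1
  · refine ⟨1, one_pos, fun A hA K hKA hB u hu => ?_⟩
    simp only [ENNReal.rpow_one]
    refine (lintegral_enorm_kernelOp_le K hu.measurable).trans ?_
    gcongr
    norm_num
    exact hKA
  have hp0 : 0 < p := by linarith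
  rcases lt_trichotomy p 2 with hp2 | rfl | hp2
  · have h1 : 0 < 2 - p := by linarith
    have h2 : 0 < p - 1 := by linarith
    refine ⟨p * (4 * B ^ 2 / (2 - p) + 2 / (p - 1)), by positivity, fun A hA K hKA hB u hu => ?_⟩
    have hΨ : Measurable (Function.uncurry fun (s : ℝ) (x : Rd d) =>
        ENNReal.ofReal ((2 / s) ^ 2) * (ENNReal.ofReal (B ^ 2) * ‖smallPart u (A * s) x‖ₑ ^ 2) +
        ENNReal.ofReal (2 / s) * (ENNReal.ofReal A * ‖largePart u (A * s) x‖ₑ)) := by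
      have hm : Measurable fun z : ℝ × Rd d => (A * z.1, z.2) := by fun_prop
      have h3 := ((measurable_smallPart hu.measurable).comp hm).enorm.pow_const 2
      have h4 := ((measurable_largePart hu.measurable).comp hm).enorm
      exact (Measurable.mul (by fun_prop) (h3.const_mul _)).add
        (Measurable.mul (by fun_prop) (h4.const_mul _))
    have h := lintegral_rpow_le_of_distribution (hf0 K u)
      (aestronglyMeasurable_kernelOp K hu.measurable).norm.aemeasurable hp0 hΨ
      fun s hs => distribution_kernelOp_le_of_small hB0 hKA hB hu hs
    simp only [enorm_rpow_eq (kernelOp K u _) hp0.le]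
    refine h.trans_eq ?_
    have h5 (x : Rd d) : ∫⁻ s in Ioi (0 : ℝ), (ENNReal.ofReal ((2 / s) ^ 2) *
        (ENNReal.ofReal (B ^ 2) * ‖smallPart u (A * s) x‖ₑ ^ 2) +
        ENNReal.ofReal (2 / s) * (ENNReal.ofReal A * ‖largePart u (A * s) x‖ₑ)) *
        ENNReal.ofReal (s ^ (p - 1)) =
        ENNReal.ofReal ((4 * B ^ 2 / (2 - p) + 2 / (p - 1)) * A ^ (2 - p)) * ‖u x‖ₑ ^ p := by
      simp only [add_mul]
      rw [lintegral_add_left, lintegral_smallPart_sq hp1 hp2 hA, lintegral_largePart hp1 hA,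
        ← add_mul, ← ENNReal.ofReal_add (by positivity) (by positivity)]
      have h3 : Measurable fun s => ‖smallPart u (A * s) x‖ₑ ^ 2 :=
        ((measurable_smallPart hu.measurable).comp
          (f := fun s : ℝ => (A * s, x)) (by fun_prop)).enorm.pow_const 2
      exact (Measurable.mul (by fun_prop) (h3.const_mul _)).mul (by fun_prop)
    simp only [h5]
    rw [lintegral_const_mul _ (hu.measurable.enorm.pow_const p), ← mul_assoc,
      ← ENNReal.ofReal_mul hp0.le, abs_sub_comm, abs_of_pos h1, mul_assoc]
  · refine ⟨B ^ 2, by positivity, fun A hA K hKA hB u hu => ?_⟩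
    simpa using lintegral_enorm_sq_kernelOp_le K hB0 hB hu
  · have h1 : 0 < p - 2 := by linarith
    refine ⟨p * (4 * B ^ 2 * (2 ^ (p - 2) / (p - 2))), by positivity, fun A hA K hKA hB u hu => ?_⟩
    have hΨ : Measurable (Function.uncurry fun (s : ℝ) (x : Rd d) =>
        ENNReal.ofReal ((2 / s) ^ 2) *
          (ENNReal.ofReal (B ^ 2) * ‖largePart u (s / (2 * A)) x‖ₑ ^ 2)) := by
      have hm : Measurable fun z : ℝ × Rd d => (z.1 / (2 * A), z.2) := by fun_prop
      have h3 := ((measurable_largePart hu.measurable).comp hm).enorm.pow_const 2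
      exact Measurable.mul (by fun_prop) (h3.const_mul _)
    have h := lintegral_rpow_le_of_distribution (hf0 K u)
      (aestronglyMeasurable_kernelOp K hu.measurable).norm.aemeasurable hp0 hΨ
      fun s hs => distribution_kernelOp_le_of_large hA hB0 hKA hB hu hs
    simp only [enorm_rpow_eq (kernelOp K u _) hp0.le]
    refine h.trans_eq ?_
    simp only [lintegral_largePart_sq hp2 hA]
    rw [lintegral_const_mul _ (hu.measurable.enorm.pow_const p), ← mul_assoc,
      ← ENNReal.ofReal_mul hp0.le, abs_of_pos h1, mul_assoc p]

end Interpolation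

/-! ### The `L¹` norm of the localized Schrödinger kernel. -/

section Kernel

open scoped ContDiff

variable {d : ℕ}

/-- The function with Fourier transform `e^{-π b |ξ|²}`. -/
noncomputable def gaussKernel (d : ℕ) (b : ℂ) (v : Rd d) : ℂ :=
  b ^ (-((d / 2 : ℝ) : ℂ)) * Complex.exp (-(Real.pi / b) * ‖v‖ ^ 2)

theorem continuous_gaussKernel (b : ℂ) : Continuous (gaussKernel d b) := by
  unfold gaussKernel
  fun_prop

theorem re_pi_div {b : ℂ} (hb : b.re = 1) : (Real.pi / b : ℂ).re = Real.pi / ‖b‖ ^ 2 := by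
  rw [Complex.div_re, Complex.normSq_eq_norm_sq, hb]
  simp

theorem norm_gaussKernel {b : ℂ} (hb : b.re = 1) (v : Rd d) :
    ‖gaussKernel d b v‖ =
      ‖b‖ ^ (-(d / 2 : ℝ)) * Real.exp (-(Real.pi / ‖b‖ ^ 2) * ‖v‖ ^ 2) := by
  rw [gaussKernel, norm_mul, ← Complex.ofReal_neg, Complex.norm_cpow_real, Complex.norm_exp,
    ← re_pi_div hb, ← Complex.ofReal_pow, Complex.re_mul_ofReal, Complex.neg_re]

theorem norm_pos_of_re_eq_one {b : ℂ} (hb : b.re = 1) : 0 < ‖b‖ :=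
  norm_pos_iff.2 fun h => by simp [h] at hb

theorem integrable_gaussKernel {b : ℂ} (hb : b.re = 1) : Integrable (gaussKernel d b) := by
  have hpos : 0 < (Real.pi / b : ℂ).re := by
    rw [re_pi_div hb]
    have := norm_pos_of_re_eq_one hb
    positivity
  have h := GaussianFourier.integrable_cexp_neg_mul_sq_norm_add hpos 0 (0 : Rd d)
  simp only [zero_mul, add_zero] at h
  exact h.const_mul _

/-- The prefactor contributes `‖b‖ ^ (-d/2)` and the real Gaussian `‖b‖ ^ d`, because `Re (π / b) =
π / ‖b‖²` when `Re b = 1`. -/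
theorem integral_norm_gaussKernel {b : ℂ} (hb : b.re = 1) :
    ∫ v, ‖gaussKernel d b v‖ = ‖b‖ ^ (d / 2 : ℝ) := by
  have hpos := norm_pos_of_re_eq_one hb
  simp only [norm_gaussKernel hb]
  rw [integral_const_mul, GaussianFourier.integral_rexp_neg_mul_sq_norm (by positivity),
    div_div_cancel₀ Real.pi_ne_zero, ← Real.rpow_natCast, ← Real.rpow_mul hpos.le,
    ← Real.rpow_add hpos]
  congr 1
  rw [finrank_euclideanSpace, Fintype.card_fin]
  push_cast
  ring

theorem fourier_gaussKernel {b : ℂ} (hb : b.re = 1) (w : Rd d) :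
    𝓕 (gaussKernel d b) w = Complex.exp (-Real.pi * b * ‖w‖ ^ 2) := by
  have hb0 : b ≠ 0 := norm_pos_iff.1 (norm_pos_of_re_eq_one hb)
  have hpi : (Real.pi : ℂ) ≠ 0 := Complex.ofReal_ne_zero.2 Real.pi_ne_zero
  have hpos : 0 < (Real.pi / b : ℂ).re := by
    rw [re_pi_div hb]
    have := norm_pos_of_re_eq_one hb
    positivity
  have h := fourier_gaussian_innerProductSpace hpos w
  have hG : gaussKernel d b = b ^ (-((d / 2 : ℝ) : ℂ)) •
      fun v : Rd d => Complex.exp (-(Real.pi / b) * ‖v‖ ^ 2) := rfl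
  have h2 : 𝓕 (b ^ (-((d / 2 : ℝ) : ℂ)) •
      fun v : Rd d => Complex.exp (-(Real.pi / b) * ‖v‖ ^ 2)) w = b ^ (-((d / 2 : ℝ) : ℂ)) *
      𝓕 (fun v : Rd d => Complex.exp (-(Real.pi / b) * ‖v‖ ^ 2)) w := by
    rw [Real.fourier_eq, Real.fourier_eq, ← integral_const_mul]
    refine integral_congr_ae (.of_forall fun v => ?_)
    simp only [Pi.smul_apply, smul_eq_mul]
    exact (mul_smul_comm _ _ _).symm
  rw [hG, h2, h, div_div_cancel₀ hpi, finrank_euclideanSpace, Fintype.card_fin, ← mul_assoc]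
  rw [Complex.cpow_neg]
  push_cast
  rw [inv_mul_cancel₀ (by simp [Complex.cpow_eq_zero_iff, hb0]), one_mul]
  congr 1
  field_simp

/-- A smooth cutoff, equal to one near the cube `[-1,1]^d`. -/
noncomputable def cutoffBump (d : ℕ) : ContDiffBump (0 : Rd d) :=
  ⟨d + 1, d + 2, by positivity, by linarith⟩

theorem cutoffBump_eq_one {η : Rd d} (h : ∀ i, η i ∈ Icc (-1 : ℝ) 1) : cutoffBump d η = 1 := by
  refine (cutoffBump d).one_of_mem_closedBall ?_
  rw [mem_closedBall_zero_iff]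
  change ‖η‖ ≤ d + 1
  have h1 : ‖η‖ ^ 2 ≤ d := by
    rw [EuclideanSpace.norm_sq_eq]
    calc ∑ i, ‖η i‖ ^ 2 ≤ ∑ _i : Fin d, (1 : ℝ) := Finset.sum_le_sum fun i _ => by
          rw [Real.norm_eq_abs, sq_abs, sq_le_one_iff_abs_le_one, abs_le]
          exact h i
      _ = d := by simp
  -- The cube lies in the ball of radius `√d ≤ d + 1`, the inner radius of the bump.
  nlinarith [norm_nonneg η, (Nat.cast_nonneg d : (0 : ℝ) ≤ d)]

theorem hasCompactSupport_cutoffBump_mul (g : Rd d → ℂ) :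
    HasCompactSupport fun η => (cutoffBump d η : ℂ) * g η :=
  ((cutoffBump d).hasCompactSupport.comp_left Complex.ofReal_zero).mul_right

theorem contDiff_cutoffBump_mul {g : Rd d → ℂ} (hg : ContDiff ℝ ∞ g) :
    ContDiff ℝ ∞ fun η => (cutoffBump d η : ℂ) * g η :=
  (Complex.ofRealCLM.contDiff.comp (cutoffBump d).contDiff).mul hg

/-- The cutoff as a Schwartz function. -/
noncomputable def cutoff (d : ℕ) : 𝓢(Rd d, ℂ) :=
  (hasCompactSupport_cutoffBump_mul (fun _ : Rd d => (1 : ℂ))).toSchwartzMap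
    (contDiff_cutoffBump_mul contDiff_const)

theorem cutoff_apply (η : Rd d) : cutoff d η = cutoffBump d η := mul_one _

theorem norm_cutoff_le (η : Rd d) : ‖cutoff d η‖ ≤ 1 := by
  rw [cutoff_apply, Complex.norm_real, Real.norm_of_nonneg (cutoffBump d).nonneg]
  exact (cutoffBump d).le_one

theorem contDiff_cexp_pi_mul_sq_norm :
    ContDiff ℝ ∞ fun η : Rd d => Complex.exp ((Real.pi * ‖η‖ ^ 2 : ℝ)) :=
  Complex.contDiff_exp.comp (Complex.ofRealCLM.contDiff.comp (contDiff_const.mul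
    (contDiff_norm_sq ℝ)))

/-- The cutoff multiplied by `e^{π|η|²}`, as a Schwartz function. -/
noncomputable def gaussCutoff (d : ℕ) : 𝓢(Rd d, ℂ) :=
  (hasCompactSupport_cutoffBump_mul
    (fun η : Rd d => Complex.exp ((Real.pi * ‖η‖ ^ 2 : ℝ)))).toSchwartzMap
      (contDiff_cutoffBump_mul contDiff_cexp_pi_mul_sq_norm)

theorem gaussCutoff_apply (η : Rd d) :
    gaussCutoff d η = cutoffBump d η * Complex.exp ((Real.pi * ‖η‖ ^ 2 : ℝ)) := rfl

/-- The complex parameter of the Gaussian that represents `S(τ)`. -/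
noncomputable def gaussParam (τ : ℝ) : ℂ := 1 - 4 * Real.pi * τ * Complex.I

theorem re_gaussParam (τ : ℝ) : (gaussParam τ).re = 1 := by simp [gaussParam]

/-- The symbol alone is an oscillating Gaussian without decay. Real part `1` in `gaussParam`
supplies decay, and the factor `e^{π|η|²}` undoing it is harmless on the compact support of the
cutoff. -/
theorem gaussCutoff_mul_exp (τ : ℝ) (η : Rd d) :
    gaussCutoff d η * Complex.exp (-Real.pi * gaussParam τ * ‖η‖ ^ 2) =
      schrodingerSymbol τ η * cutoff d η := by
  rw [gaussCutoff_apply, cutoff_apply, mul_assoc, ← Complex.exp_add, schrodingerSymbol, mul_comm]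
  congr 2
  rw [gaussParam]
  push_cast
  ring

/-- Both sides have the same Fourier transform by `gaussCutoff_mul_exp`. Equality at every point
follows from Fourier inversion, since the convolution is continuous and integrable and its transform
is a Schwartz function. -/
theorem kernelOp_gaussKernel (τ : ℝ) :
    kernelOp (𝓕⁻ (gaussCutoff d)) (gaussKernel d (gaussParam τ)) =
      (𝓕⁻ (SchwartzMap.smulLeftCLM ℂ (schrodingerSymbol τ) (cutoff d)) : 𝓢(Rd d, ℂ)) := by
  let H : 𝓢(Rd d, ℂ) := 𝓕⁻ (gaussCutoff d)
  have hG := integrable_gaussKernel (d := d) (re_gaussParam τ)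
  have hconv : kernelOp H (gaussKernel d (gaussParam τ)) =
      convolution H (gaussKernel d (gaussParam τ)) (ContinuousLinearMap.mul ℂ ℂ) volume := rfl
  have hbdd : BddAbove (range fun x => ‖H x‖) :=
    ⟨SchwartzMap.seminorm ℝ 0 0 H, by
      rintro _ ⟨x, rfl⟩
      exact SchwartzMap.norm_le_seminorm ℝ H x⟩
  have hcont : Continuous (kernelOp H (gaussKernel d (gaussParam τ))) := by
    rw [hconv]
    exact hbdd.continuous_convolution_left_of_integrable _ H.continuous hG
  have hint : Integrable (kernelOp H (gaussKernel d (gaussParam τ))) := by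
    rw [hconv]
    exact H.integrable.integrable_convolution _ hG
  have hF : 𝓕 (kernelOp H (gaussKernel d (gaussParam τ))) =
      (SchwartzMap.smulLeftCLM ℂ (schrodingerSymbol τ) (cutoff d) : 𝓢(Rd d, ℂ)) := by
    ext ξ
    rw [hconv, Real.fourier_mul_convolution_eq H.integrable hG,
      fourier_gaussKernel (re_gaussParam τ), ← SchwartzMap.fourier_coe,
      FourierTransform.fourier_fourierInv_eq, gaussCutoff_mul_exp,
      SchwartzMap.smulLeftCLM_apply_apply (hasTemperateGrowth_schrodingerSymbol τ), smul_eq_mul]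
  rw [SchwartzMap.fourierInv_coe, ← hF]
  refine (hcont.fourierInv_fourier_eq hint ?_).symm
  rw [hF]
  exact SchwartzMap.integrable _

theorem norm_gaussParam_le (τ : ℝ) : ‖gaussParam τ‖ ≤ 4 * Real.pi * japanese τ := by
  have h : gaussParam τ = ((1 : ℝ) : ℂ) + ((-(4 * Real.pi * τ) : ℝ) : ℂ) * Complex.I := by
    rw [gaussParam]; push_cast; ring
  rw [h, Complex.norm_add_mul_I, japanese]
  refine Real.sqrt_le_iff.2 ⟨by positivity, ?_⟩
  rw [mul_pow, Real.sq_sqrt (by positivity), sq_abs]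
  nlinarith [Real.pi_gt_three, sq_nonneg (Real.pi * τ)]

theorem exists_lintegral_fourierInv_cutoff_le (d : ℕ) : ∃ C > 0, ∀ τ : ℝ,
    ∫⁻ y, ‖(𝓕⁻ (SchwartzMap.smulLeftCLM ℂ (schrodingerSymbol τ) (cutoff d)) : 𝓢(Rd d, ℂ)) y‖ₑ ≤
      ENNReal.ofReal (C * japanese τ ^ (d / 2 : ℝ)) := by
  let H : 𝓢(Rd d, ℂ) := 𝓕⁻ (gaussCutoff d)
  let C0 := ∫ y, ‖H y‖
  have hC0 : 0 ≤ C0 := integral_nonneg fun y => norm_nonneg _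
  -- `C0` is the `L¹` norm of the factor independent of `τ`; adding `1` makes the constant strictly
  -- positive.
  refine ⟨(C0 + 1) * (4 * Real.pi) ^ (d / 2 : ℝ), by positivity, fun τ => ?_⟩
  rw [← kernelOp_gaussKernel]
  refine (lintegral_enorm_kernelOp_le _ (continuous_gaussKernel _).measurable).trans ?_
  rw [← ofReal_integral_norm_eq_lintegral_enorm H.integrable,
    ← ofReal_integral_norm_eq_lintegral_enorm (integrable_gaussKernel (re_gaussParam τ)),
    integral_norm_gaussKernel (re_gaussParam τ), ← ENNReal.ofReal_mul hC0]
  refine ENNReal.ofReal_le_ofReal ?_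
  have hj : 0 ≤ japanese τ := Real.sqrt_nonneg _
  rw [mul_assoc, ← Real.mul_rpow (by positivity) hj]
  refine mul_le_mul (by linarith) ?_ (by positivity) (by positivity)
  exact Real.rpow_le_rpow (norm_nonneg _) (norm_gaussParam_le τ) (by positivity)

/-- Galilean invariance. Substituting `ξ = 2^j (η + k)` splits `|ξ|²` into three terms: the
quadratic one gives the symbol at time `2^{2j} t`, the cross term a translation in space, and the
constant one a unimodular phase. -/
theorem norm_fourierInv_multiplier (θ : 𝓢(Rd d, ℂ)) (j : ℤ) (k : Fin d → ℤ) (t : ℝ) (y : Rd d) :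
    ‖(𝓕⁻ (SchwartzMap.smulLeftCLM ℂ (schrodingerSymbol t) (multiplier θ j k)) : 𝓢(Rd d, ℂ)) y‖ =
      ((2 : ℝ) ^ j) ^ d * ‖(𝓕⁻ (SchwartzMap.smulLeftCLM ℂ
        (schrodingerSymbol ((2 : ℝ) ^ (2 * j) * t)) θ) : 𝓢(Rd d, ℂ))
        ((2 : ℝ) ^ j • y + (4 * Real.pi * ((2 : ℝ) ^ (2 * j) * t)) • latticePoint k)‖ := by
  set c : ℝ := (2 : ℝ) ^ j with hc
  have hc0 : 0 < c := by positivity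
  have hcj : (2 : ℝ) ^ (-j) = c⁻¹ := zpow_neg _ _
  have hτ : (2 : ℝ) ^ (2 * j) * t = c ^ 2 * t := by
    rw [hc, ← zpow_natCast, ← zpow_mul, mul_comm j]
    rfl
  rw [hτ]
  set τ := c ^ 2 * t with hτ'
  set κ : Rd d := latticePoint k
  rw [SchwartzMap.fourierInv_coe, SchwartzMap.fourierInv_coe, Real.fourierInv_eq',
    Real.fourierInv_eq']
  set g : Rd d → ℂ := fun ξ => Complex.exp (↑(2 * Real.pi * inner ℝ ξ y) * Complex.I) •
    (SchwartzMap.smulLeftCLM ℂ (schrodingerSymbol t) (multiplier θ j k)) ξ with hg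
  have h1 : ∫ ξ, g ξ = c ^ d • ∫ η, g (c • (η + κ)) := by
    rw [integral_add_right_eq_self (fun η => g (c • η)) κ,
      Measure.integral_comp_smul_of_nonneg volume g c (hR := hc0.le), finrank_euclideanSpace,
      Fintype.card_fin, smul_smul, mul_inv_cancel₀ (by positivity), one_smul]
  let P : ℂ := Complex.exp ((2 * Real.pi * c * inner ℝ κ y + 4 * Real.pi ^ 2 * τ * ‖κ‖ ^ 2 : ℝ) *
    Complex.I)
  have h2 (η : Rd d) : g (c • (η + κ)) = P * (Complex.exp (↑(2 * Real.pi *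
      inner ℝ η (c • y + (4 * Real.pi * τ) • κ)) * Complex.I) •
      (SchwartzMap.smulLeftCLM ℂ (schrodingerSymbol τ) θ) η) := by
    simp only [hg, SchwartzMap.smulLeftCLM_apply_apply (hasTemperateGrowth_schrodingerSymbol _),
      multiplier_apply, hcj, smul_smul, inv_mul_cancel₀ hc0.ne', one_smul, add_sub_cancel_right,
      smul_eq_mul, schrodingerSymbol, P, ← mul_assoc, ← Complex.exp_add, κ]
    congr 2
    rw [norm_smul, mul_pow, norm_add_sq_real, inner_smul_left, inner_add_left, inner_add_right,
      inner_smul_right, inner_smul_right, hτ', Real.norm_of_nonneg hc0.le]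
    push_cast
    simp
    ring
  have hP : ‖P‖ = 1 := Complex.norm_exp_ofReal_mul_I _
  rw [h1]
  simp only [h2]
  rw [integral_const_mul, norm_smul, norm_mul, hP, one_mul, Real.norm_of_nonneg (by positivity)]

theorem lintegral_fourierInv_multiplier (θ : 𝓢(Rd d, ℂ)) (j : ℤ) (k : Fin d → ℤ) (t : ℝ) :
    ∫⁻ y, ‖(𝓕⁻ (SchwartzMap.smulLeftCLM ℂ (schrodingerSymbol t) (multiplier θ j k)) :
        𝓢(Rd d, ℂ)) y‖ₑ =
      ∫⁻ y, ‖(𝓕⁻ (SchwartzMap.smulLeftCLM ℂ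
        (schrodingerSymbol ((2 : ℝ) ^ (2 * j) * t)) θ) : 𝓢(Rd d, ℂ)) y‖ₑ := by
  rw [← ofReal_integral_norm_eq_lintegral_enorm (SchwartzMap.integrable _),
    ← ofReal_integral_norm_eq_lintegral_enorm (SchwartzMap.integrable _)]
  congr 1
  simp only [norm_fourierInv_multiplier]
  set f : Rd d → ℝ := fun y => ‖(𝓕⁻ (SchwartzMap.smulLeftCLM ℂ
        (schrodingerSymbol ((2 : ℝ) ^ (2 * j) * t)) θ) : 𝓢(Rd d, ℂ)) y‖
  set a : Rd d := (4 * Real.pi * ((2 : ℝ) ^ (2 * j) * t)) • latticePoint k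
  have h := Measure.integral_comp_smul_of_nonneg volume (fun y => f (y + a)) ((2 : ℝ) ^ j)
    (hR := by positivity)
  rw [integral_add_right_eq_self, finrank_euclideanSpace, Fintype.card_fin, smul_eq_mul] at h
  rw [integral_const_mul]
  change _ * ∫ y, f ((2 : ℝ) ^ j • y + a) = _
  rw [h, ← mul_assoc, mul_inv_cancel₀ (by positivity), one_mul]

end Kernel

/-! ### From the kernel bound to the scaled norms and the weights. -/

section Estimates

variable {d : ℕ}

theorem smulLeftCLM_character_character (x y : Rd d) (χ : 𝓢(Rd d, ℂ)) :
    SchwartzMap.smulLeftCLM ℂ (character y) (SchwartzMap.smulLeftCLM ℂ (character x) χ) =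
      SchwartzMap.smulLeftCLM ℂ (character (x + y)) χ := by
  ext ξ
  simp only [SchwartzMap.smulLeftCLM_apply_apply (hasTemperateGrowth_character _), smul_eq_mul,
    character_add]
  ring

/-- The tempered distribution `f` as a continuous linear functional. -/
noncomputable def toFunctional (f : 𝓢'(Rd d, ℂ)) : 𝓢(Rd d, ℂ) →L[ℂ] ℂ := f

theorem polynomialGrowth_piece (ψ : 𝓢(Rd d, ℂ)) (j : ℤ) (k : Fin d → ℤ) (f : 𝓢'(Rd d, ℂ)) :
    PolynomialGrowth (piece ψ j k f) := by
  have h := commutesWithModulationIntegral_functional (toFunctional (𝓕 f))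
  exact ⟨(h.continuous (multiplier ψ j k)).measurable, h.bound (multiplier ψ j k)⟩

/-- The kernel of the Schrödinger operator localized to the cube of index `(j, k)`. -/
noncomputable def localizedKernel (t : ℝ) (j : ℤ) (k : Fin d → ℤ) : 𝓢(Rd d, ℂ) :=
  𝓕⁻ (SchwartzMap.smulLeftCLM ℂ (schrodingerSymbol t) (multiplier (cutoff d) j k))

theorem fourier_localizedKernel_apply (t : ℝ) (j : ℤ) (k : Fin d → ℤ) (ξ : Rd d) :
    (𝓕 (localizedKernel t j k) : 𝓢(Rd d, ℂ)) ξ =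
      schrodingerSymbol t ξ * multiplier (cutoff d) j k ξ := by
  rw [localizedKernel, FourierTransform.fourier_fourierInv_eq,
    SchwartzMap.smulLeftCLM_apply_apply (hasTemperateGrowth_schrodingerSymbol t), smul_eq_mul]

theorem norm_fourier_localizedKernel_le (t : ℝ) (j : ℤ) (k : Fin d → ℤ) (ξ : Rd d) :
    ‖(𝓕 (localizedKernel t j k) : 𝓢(Rd d, ℂ)) ξ‖ ≤ 1 := by
  have h : ‖schrodingerSymbol t ξ‖ = 1 := Complex.norm_exp_ofReal_mul_I _
  rw [fourier_localizedKernel_apply, norm_mul, h, one_mul, multiplier_apply]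
  exact norm_cutoff_le _

theorem cutoff_mul_multiplier {ψ : 𝓢(Rd d, ℂ)}
    (hψ : tsupport (ψ : Rd d → ℂ) ⊆ {ξ | ∀ i, ξ i ∈ Icc (-1 : ℝ) 1})
    (j : ℤ) (k : Fin d → ℤ) (ξ : Rd d) :
    multiplier (cutoff d) j k ξ * multiplier ψ j k ξ = multiplier ψ j k ξ := by
  rw [multiplier_apply, multiplier_apply]
  by_cases h : ψ ((2 : ℝ) ^ (-j) • ξ - latticePoint k) = 0
  · rw [h, mul_zero]
  · rw [cutoff_apply, cutoffBump_eq_one (hψ (subset_tsupport _ h)), Complex.ofReal_one, one_mul]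

/-- The cutoff equals `1` wherever `ψ_{j,k}` is nonzero, so the symbol may be replaced by the
Fourier transform of `localizedKernel`. Exchanging functional and integral then gives a convolution,
because modulation by `-y` turns the character at `x` into the one at `x - y`. -/
theorem piece_S {ψ : 𝓢(Rd d, ℂ)}
    (hψ : tsupport (ψ : Rd d → ℂ) ⊆ {ξ | ∀ i, ξ i ∈ Icc (-1 : ℝ) 1})
    (j : ℤ) (k : Fin d → ℤ) (t : ℝ) (f : 𝓢'(Rd d, ℂ)) :
    piece ψ j k (S t f) = kernelOp (localizedKernel t j k) (piece ψ j k f) := by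
  ext x
  have h1 : piece ψ j k (S t f) x = toFunctional (𝓕 f) (SchwartzMap.smulLeftCLM ℂ
      (schrodingerSymbol t) (SchwartzMap.smulLeftCLM ℂ (character x) (multiplier ψ j k))) := by
    rw [piece, S, TemperedDistribution.fourierMultiplierCLM_apply,
      FourierTransform.fourier_fourierInv_eq, TemperedDistribution.smulLeftCLM_apply_apply]
    rfl
  have h2 : SchwartzMap.smulLeftCLM ℂ (schrodingerSymbol t)
      (SchwartzMap.smulLeftCLM ℂ (character x) (multiplier ψ j k)) =
      SchwartzMap.smulLeftCLM ℂ (𝓕 (localizedKernel t j k) : 𝓢(Rd d, ℂ))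
        (SchwartzMap.smulLeftCLM ℂ (character x) (multiplier ψ j k)) := by
    ext ξ
    rw [SchwartzMap.smulLeftCLM_apply_apply (hasTemperateGrowth_schrodingerSymbol t),
      SchwartzMap.smulLeftCLM_apply_apply (SchwartzMap.hasTemperateGrowth _),
      SchwartzMap.smulLeftCLM_apply_apply (hasTemperateGrowth_character x),
      fourier_localizedKernel_apply]
    simp only [smul_eq_mul]
    conv_lhs => rw [← cutoff_mul_multiplier hψ]
    ring
  rw [h1, h2, (commutesWithModulationIntegral_functional (toFunctional (𝓕 f))).integral]
  refine integral_congr_ae (.of_forall fun y => ?_)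
  simp only [smulLeftCLM_character_character, ← sub_eq_add_neg, smul_eq_mul]
  rfl

theorem exists_eLpNorm_piece_S_le (d : ℕ) {p : ℝ} (hp : 1 ≤ p) :
    ∃ C : ℝ≥0, ∀ ψ : 𝓢(Rd d, ℂ),
      tsupport (ψ : Rd d → ℂ) ⊆ {ξ | ∀ i, ξ i ∈ Icc (-1 : ℝ) 1} →
      ∀ (j : ℤ) (k : Fin d → ℤ) (t : ℝ) (f : 𝓢'(Rd d, ℂ)),
      eLpNorm (piece ψ j k (S t f)) (ENNReal.ofReal p) volume ≤
        C * ENNReal.ofReal (japanese ((2 : ℝ) ^ (2 * j) * t) ^ ((d : ℝ) * |1 / 2 - 1 / p|)) *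
          eLpNorm (piece ψ j k f) (ENNReal.ofReal p) volume := by
  have hp0 : 0 < p := by linarith
  obtain ⟨C₁, hC₁, h₁⟩ := exists_lintegral_fourierInv_cutoff_le d
  -- Here `B = 1`, as the symbol is unimodular and the cutoff is at most `1`.
  obtain ⟨C₂, hC₂, h₂⟩ := exists_lintegral_kernelOp_rpow_le d hp one_pos
  refine ⟨((C₂ * C₁ ^ |p - 2|) ^ (1 / p)).toNNReal, fun ψ hψ j k t f => ?_⟩
  set J := japanese ((2 : ℝ) ^ (2 * j) * t)
  have hJ : 0 < J := Real.sqrt_pos.2 (by positivity)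
  have h3 := h₂ (C₁ * J ^ (d / 2 : ℝ)) (by positivity) (localizedKernel t j k)
    ((lintegral_fourierInv_multiplier (cutoff d) j k t).trans_le (h₁ _))
    (norm_fourier_localizedKernel_le t j k) _ (polynomialGrowth_piece ψ j k f)
  rw [← piece_S hψ] at h3
  have hne : ENNReal.ofReal p ≠ 0 := (ENNReal.ofReal_pos.2 hp0).ne'
  rw [eLpNorm_eq_lintegral_rpow_enorm_toReal hne ENNReal.ofReal_ne_top,
    eLpNorm_eq_lintegral_rpow_enorm_toReal hne ENNReal.ofReal_ne_top, ENNReal.toReal_ofReal hp0.le]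
  refine (ENNReal.rpow_le_rpow h3 (by positivity)).trans_eq ?_
  rw [ENNReal.mul_rpow_of_nonneg _ _ (by positivity)]
  congr 1
  rw [ENNReal.ofReal_rpow_of_nonneg (by positivity) (by positivity)]
  -- The coercion of `Real.toNNReal` is `ENNReal.ofReal` by definition.
  change _ = ENNReal.ofReal _ * _
  rw [← ENNReal.ofReal_mul (by positivity)]
  congr 1
  rw [Real.mul_rpow hC₁.le (by positivity), ← mul_assoc, Real.mul_rpow (by positivity)
    (by positivity), ← Real.rpow_mul hJ.le, ← Real.rpow_mul hJ.le]
  congr 2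
  -- Matches the exponent `(d / 2) * |p - 2| * (1 / p)` left by the `p`-th root.
  have : |1 / 2 - 1 / p| = |p - 2| / 2 / p := by
    rw [show 1 / 2 - 1 / p = (p - 2) / (2 * p) by field_simp, abs_div,
      abs_of_pos (by positivity : 0 < 2 * p)]
    field_simp
  rw [this]
  ring

/-- Serves twice: for the `ℓ^q` sum over `k` in (a) and the `ℓ^r` sum over `j` in (b). -/
theorem tsum_rpow_le_of_le {ι : Type} {a b : ι → ℝ≥0∞} {D : ℝ≥0∞} {q : ℝ} (hq : 0 < q)
    (h : ∀ i, a i ≤ D * b i) :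
    (∑' i, a i ^ q) ^ (1 / q) ≤ D * (∑' i, b i ^ q) ^ (1 / q) := by
  have h1 : ∑' i, a i ^ q ≤ D ^ q * ∑' i, b i ^ q := by
    rw [← ENNReal.tsum_mul_left]
    refine ENNReal.tsum_le_tsum fun i => ?_
    rw [← ENNReal.mul_rpow_of_nonneg _ _ hq.le]
    exact ENNReal.rpow_le_rpow (h i) hq.le
  refine (ENNReal.rpow_le_rpow h1 (by positivity)).trans_eq ?_
  rw [ENNReal.mul_rpow_of_nonneg _ _ (by positivity), ← ENNReal.rpow_mul,
    mul_one_div_cancel hq.ne', ENNReal.rpow_one]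

theorem one_le_japanese (x : ℝ) : 1 ≤ japanese x :=
  Real.one_le_sqrt.2 (by nlinarith [sq_nonneg |x|])

theorem japanese_le_of_neg {j : ℤ} (hj : j < 0) (t : ℝ) :
    japanese ((2 : ℝ) ^ (2 * j) * t) ≤ japanese t := by
  refine Real.sqrt_le_sqrt ?_
  have h : (2 : ℝ) ^ (2 * j) ≤ 1 := zpow_le_one_of_nonpos₀ one_le_two (by omega)
  have h0 : (0 : ℝ) < 2 ^ (2 * j) := by positivity
  rw [abs_mul, abs_of_pos h0]
  gcongr
  exact mul_le_of_le_one_left (abs_nonneg t) h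

theorem japanese_le_of_nonneg {j : ℤ} (hj : 0 ≤ j) (t : ℝ) :
    japanese ((2 : ℝ) ^ (2 * j) * t) ≤ (2 : ℝ) ^ (2 * j) * japanese t := by
  have h : (1 : ℝ) ≤ 2 ^ (2 * j) := one_le_zpow₀ one_le_two (by omega)
  refine Real.sqrt_le_iff.2 ⟨mul_nonneg (by positivity) (Real.sqrt_nonneg _), ?_⟩
  rw [mul_pow, japanese, Real.sq_sqrt (by positivity), abs_mul, mul_pow,
    abs_of_pos (by positivity : (0 : ℝ) < 2 ^ (2 * j))]
  nlinarith [one_le_pow₀ (n := 2) h]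

theorem dampedWeight_le {p : ℝ} (w : ℤ → ℝ≥0) (j : ℤ) : dampedWeight d p w j ≤ w j := by
  unfold dampedWeight
  split_ifs with hj
  · refine mul_le_of_le_one_left (zero_le) ?_
    refine NNReal.rpow_le_one_of_one_le_of_nonpos one_le_two ?_
    have : (0 : ℝ) ≤ j := by exact_mod_cast hj
    have : 0 ≤ (j : ℝ) * d * |1 - 2 / p| := by positivity
    linarith
  · exact le_rfl

theorem GoodWeight.mono {p q : ℝ} {w σ : ℤ → ℝ≥0} (hw : GoodWeight d p q w)
    (h : ∀ j, σ j ≤ w j) : GoodWeight d p q σ := by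
  obtain ⟨ε, hε, A, h1, h2⟩ := hw
  exact ⟨ε, hε, A, fun j hj => (NNReal.coe_le_coe.2 (h j)).trans (h1 j hj),
    fun j hj => (NNReal.coe_le_coe.2 (h j)).trans (h2 j hj)⟩

/-- With `α = d|1/2 - 1/p|`, for `j ≥ 0` the bracket costs `2^{2jα}`, which the damping removes
exactly since `d|1 - 2/p| = 2α`. For `j < 0` the bracket only shrinks and no damping is needed. -/
theorem dampedWeight_mul_japanese_le {p : ℝ} (w : ℤ → ℝ≥0) (j : ℤ) (t : ℝ) :
    (dampedWeight d p w j : ℝ≥0∞) *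
        ENNReal.ofReal (japanese ((2 : ℝ) ^ (2 * j) * t) ^ ((d : ℝ) * |1 / 2 - 1 / p|)) ≤
      ENNReal.ofReal (japanese t ^ ((d : ℝ) * |1 / 2 - 1 / p|)) * w j := by
  set α := (d : ℝ) * |1 / 2 - 1 / p| with hα
  have hα0 : 0 ≤ α := by positivity
  have hJ : 0 ≤ japanese ((2 : ℝ) ^ (2 * j) * t) := zero_le_one.trans (one_le_japanese _)
  have hJt : 0 ≤ japanese t := zero_le_one.trans (one_le_japanese _)
  rw [← ENNReal.ofReal_coe_nnreal, ← ENNReal.ofReal_coe_nnreal,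
    ← ENNReal.ofReal_mul (by positivity), ← ENNReal.ofReal_mul (by positivity)]
  refine ENNReal.ofReal_le_ofReal ?_
  unfold dampedWeight
  split_ifs with hj
  · have h1 : (2 : ℝ) ^ (2 * j) = (2 : ℝ) ^ (2 * j : ℝ) := by
      rw [← Real.rpow_intCast]; push_cast; rfl
    have h2 : (d : ℝ) * |1 - 2 / p| = 2 * α := by
      rw [hα, show 1 - 2 / p = 2 * (1 / 2 - 1 / p) by ring, abs_mul, abs_two]
      ring
    have h3 := Real.rpow_le_rpow hJ (japanese_le_of_nonneg hj t) hα0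
    rw [Real.mul_rpow (by positivity) hJt, h1, ← Real.rpow_mul zero_le_two] at h3
    have h4 : ((2 : ℝ) ^ (-((j : ℝ) * d * |1 - 2 / p|))) * (2 : ℝ) ^ (2 * j * α : ℝ) = 1 := by
      rw [← Real.rpow_add two_pos, mul_assoc, h2, show -((j : ℝ) * (2 * α)) + 2 * j * α = 0 by ring,
        Real.rpow_zero]
    rw [NNReal.coe_mul, NNReal.coe_rpow, NNReal.coe_ofNat]
    calc _ ≤ (2 : ℝ) ^ (-((j : ℝ) * d * |1 - 2 / p|)) * w j *
          ((2 : ℝ) ^ (2 * j * α : ℝ) * japanese t ^ α) := by rw [← h1] at h3; gcongr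
      _ = ((2 : ℝ) ^ (-((j : ℝ) * d * |1 - 2 / p|)) * (2 : ℝ) ^ (2 * j * α : ℝ)) *
          (japanese t ^ α * w j) := by ring
      _ = _ := by rw [h4, one_mul]
  · rw [mul_comm]
    gcongr
    exact japanese_le_of_neg (not_le.1 hj) t

end Estimates
end ScaledModulation

theorem mainTheorem4 (d : ℕ) (hd : 1 ≤ d) (ψ : 𝓢(Rd d, ℂ)) (hψ : IsUniformPartition ψ)
    (p q : ℝ) (hp : 1 ≤ p) (hq : 1 ≤ q) :
    ∃ C : ℝ≥0,
      (∀ (j : ℤ) (t : ℝ) (f : 𝓢'(Rd d, ℂ)),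
        scaleNorm ψ p q j (S t f) ≤
          C * ENNReal.ofReal (japanese ((2 : ℝ) ^ (2 * j) * t) ^ ((d : ℝ) * |1 / 2 - 1 / p|)) *
            scaleNorm ψ p q j f) ∧
      (∀ (r : ℝ), 1 ≤ r → ∀ w : ℤ → ℝ≥0, GoodWeight d p q w →
        GoodWeight d p q (dampedWeight d p w) ∧
        ∀ t : ℝ,
          MapsTo (S t) (modSpace ψ p q r w) (modSpace ψ p q r (dampedWeight d p w)) ∧
          ∀ f : 𝓢'(Rd d, ℂ),
            modNorm ψ p q r (dampedWeight d p w) (S t f) ≤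
              C * ENNReal.ofReal (japanese t ^ ((d : ℝ) * |1 / 2 - 1 / p|)) *
                modNorm ψ p q r w f) := by
  obtain ⟨C, hC⟩ := exists_eLpNorm_piece_S_le d hp
  have ha (j : ℤ) (t : ℝ) (f : 𝓢'(Rd d, ℂ)) := tsum_rpow_le_of_le (q := q) (by linarith)
    fun k : Fin d → ℤ => hC ψ hψ.support_subset j k t f
  -- The constant of (a) also serves (b), as the weight comparison costs no further factor. The
  -- damped weight is good because it is dominated by `w`.
  refine ⟨C, ha, fun r hr w hw => ⟨hw.mono (dampedWeight_le w), fun t => ?_⟩⟩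
  have hr0 : 0 < r := by linarith
  have hb (f : 𝓢'(Rd d, ℂ)) : modNorm ψ p q r (dampedWeight d p w) (S t f) ≤
      C * ENNReal.ofReal (japanese t ^ ((d : ℝ) * |1 / 2 - 1 / p|)) * modNorm ψ p q r w f := by
    simp only [modNorm, ← ENNReal.mul_rpow_of_nonneg _ _ hr0.le]
    refine tsum_rpow_le_of_le hr0 fun j => ?_
    have h1 : scaleNorm ψ p q j (S t f) ≤ _ := ha j t f
    have h2 := dampedWeight_mul_japanese_le (d := d) (p := p) w j t
    calc (dampedWeight d p w j : ℝ≥0∞) * scaleNorm ψ p q j (S t f)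
        ≤ dampedWeight d p w j * (C * ENNReal.ofReal (japanese ((2 : ℝ) ^ (2 * j) * t) ^
            ((d : ℝ) * |1 / 2 - 1 / p|)) * scaleNorm ψ p q j f) := by gcongr; exact h1
      _ = C * (dampedWeight d p w j * ENNReal.ofReal (japanese ((2 : ℝ) ^ (2 * j) * t) ^
            ((d : ℝ) * |1 / 2 - 1 / p|))) * scaleNorm ψ p q j f := by ring
      _ ≤ C * (ENNReal.ofReal (japanese t ^ ((d : ℝ) * |1 / 2 - 1 / p|)) * w j) *
            scaleNorm ψ p q j f := by gcongr
      _ = _ := by ring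
  refine ⟨fun f hf => (hb f).trans_lt (ENNReal.mul_lt_top ?_ hf), hb⟩
  exact ENNReal.mul_lt_top ENNReal.coe_lt_top ENNReal.ofReal_lt_top
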